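/- **Setting.** Let $\{\psi_{lk}\}$ be an orthonormal boundary-corrected wavelet basis of $L^2[0,1]$ with coarsest level $J\ge 0$. It has $2^J$ scaling functions, which belong to level $l=J$, and $2^l$ wavelets at each level $l\ge J$. With $N\ge 0$, $2N\le 2^J$, the level-$l$ functions of each of the two kinds are $2^{l/2}g(2^lx-k)$ for $N\le k<2^l-N$, $2^{l/2}g^{\mathrm{left}}_k(2^lx)$ for $0\le k<N$, and $2^{l/2}g^{\mathrm{right}}_{k}(2^l(x-1))$, $0\le k<N$, where $g$, $g_k^{\mathrm{left}}$, $g_k^{\mathrm{right}}$ are bounded, compactly supported functions that do not depend on $l$. (The Haar basis is the case $J=N=0$.) For $f\in L^2[0,1]$ write $f_{lk}=\langle f,\psi_{lk}\rangle$, where at level $J$ the index $k$ runs over the scaling functions too, and for $\beta,L>0$ let $$\mathcal H^\beta(L)=\{f\in L^2[0,1]:\ |f_{lk}|\le 2^{-l(1/2+\beta)}L\ \text{ for all } l,k\}.$$ Let $h$ be a probability density on $\mathbb R$ that is symmetric, positive, bounded and decreasing on $[0,\infty)$ and such that, for some constants $c_1,c_2>0$ and $\kappa\ge 0$, $$\log\frac1{h(x)}\le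 c_1\bigl(1+\log^{1+\kappa}(1+x)\bigr)\quad(x\ge 0),\qquad \int_x^\infty h(u)\,du\le \frac{c_2}{x^2}\quad(x\ge 1).$$ For a positive sequence $(s_l)$ let $\Pi$ be the law on $L^2[0,1]$ of $f=\sum_{l,k}s_l\zeta_{lk}\psi_{lk}$, where the $\zeta_{lk}$ are i.i.d. with density $h$. In both cases below this series converges almost surely in $L^2[0,1]$. The norm $\|\cdot\|_\infty$ is that of $L^\infty[0,1]$. **Theorem.** 1. Let $s_l=2^{-l(1/2+\alpha)}$ with $\alpha>1/2$, and for $\beta>0$ put $$\varepsilon_n=(\log\log n)^{\frac{2}{1+2\beta}}(\log n)^{\frac{1+(1+\kappa)\beta}{1+2\beta}}\,n^{-\frac{\beta}{2\beta+1}}.$$ Then for any $0<\beta\le\alpha$, $L>0$, $f_0\in\mathcal H^\beta(L)$ and any $d_2>0$ there exists $d_1>0$ such that, for all large enough $n$, $$\Pi\bigl[\|f-f_0\|_\infty<d_1\varepsilon_n\bigr]\ge e^{-d_2n\varepsilon_n^2}.$$ 2. Let $s_l=2^{-l^2}$, and for $\beta>0$ put $$\varepsilon_n=(\log n)^{\frac{(2+2\kappa)\beta}{1+2\beta}}\,n^{-\frac{\beta}{2\beta+1}}.$$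 Then for any $\beta>0$, $L>0$, $f_0\in\mathcal H^\beta(L)$ and any $d_2>0$ there exists $d_1>0$ such that, for all large enough $n$, $$\Pi\bigl[\|f-f_0\|_\infty<d_1\varepsilon_n\bigr]\ge e^{-d_2n\varepsilon_n^2}.$$ -/

import Mathlib

open MeasureTheory Filter
open scoped ENNReal

noncomputable section

/-- The Hilbert space `L²[0,1]` of real-valued functions. -/
abbrev L2I : Type := Lp ℝ 2 (volume.restrict (Set.Icc (0 : ℝ) 1))

instance : MeasurableSpace L2I := borel L2I

instance : BorelSpace L2I := ⟨rfl⟩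

/-- The `L^∞[0,1]` norm (essential supremum of `|f|` over `[0,1]`) of `f ∈ L²[0,1]`; it may be
infinite. -/
def supNorm (f : L2I) : ℝ≥0∞ := eLpNorm f ∞ (volume.restrict (Set.Icc (0 : ℝ) 1))

/-- The `k`-th function (`0 ≤ k < 2^l`) at resolution level `l` of a boundary-corrected system with
`N` functions at each edge: for the `N` first positions a dilate of a left edge function, for the
`N` last positions a dilate, around the point `1`, of a right edge function, and in between
the usual dilated translate `2^{l/2} g (2^l x - k)` of the interior function `g`. -/
def dilatedFun (N : ℕ) (g : ℝ → ℝ) (gl gr : ℕ → ℝ → ℝ) (l k : ℕ) (x : ℝ) : ℝ :=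
  (2 : ℝ) ^ ((l : ℝ) / 2) *
    (if k < N then gl k (2 ^ l * x)
     else if k < 2 ^ l - N then g (2 ^ l * x - k)
     else gr (2 ^ l - 1 - k) (2 ^ l * (x - 1)))

/-- A generating function of a wavelet system: measurable, bounded and compactly supported. -/
structure IsGenerator (g : ℝ → ℝ) : Prop where
  measurable : Measurable g
  bounded : ∃ C : ℝ, ∀ x, |g x| ≤ C
  compactSupport : HasCompactSupport g

/-- Indices of a wavelet basis of `[0,1]` with coarsest level `J`: `Sum.inl k` is the `k`-th scaling
function at level `J`, and `Sum.inr ⟨m, k⟩` is the `k`-th wavelet at level `J + m`. -/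
abbrev WIndex (J : ℕ) : Type := Fin (2 ^ J) ⊕ (Σ m : ℕ, Fin (2 ^ (J + m)))

/-- The resolution level `l` of an index. The scaling functions belong to the coarsest level. -/
def WIndex.level {J : ℕ} : WIndex J → ℕ
  | Sum.inl _ => J
  | Sum.inr p => J + p.1

/-- An orthonormal boundary-corrected wavelet basis of `L²[0,1]`, with coarsest level `J`: there are
`2^J` scaling functions at level `J` and `2^l` wavelets at every level `l ≥ J`, all of which
are obtained by dilation (and, in the interior, translation) from finitely many bounded, compactly
supported functions, namely an interior scaling function `φ`, an interior wavelet `ψ`, and `N`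
scaling functions and `N` wavelets at each of the two edges; and together they are an orthonormal
basis of `L²[0,1]`. Regularity and vanishing moments can be of any order and are not prescribed:
the Haar basis (`J = N = 0`) and the compactly supported bases of Cohen, Daubechies and Vial are
of this form. -/
structure BoundaryCorrectedWaveletBasis where
  J : ℕ
  N : ℕ
  two_mul_N_le : 2 * N ≤ 2 ^ J
  φ : ℝ → ℝ
  φLeft : ℕ → ℝ → ℝ
  φRight : ℕ → ℝ → ℝ
  ψ : ℝ → ℝ
  ψLeft : ℕ → ℝ → ℝ
  ψRight : ℕ → ℝ → ℝ
  φ_gen : IsGenerator φ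
  φLeft_gen : ∀ k < N, IsGenerator (φLeft k)
  φRight_gen : ∀ k < N, IsGenerator (φRight k)
  ψ_gen : IsGenerator ψ
  ψLeft_gen : ∀ k < N, IsGenerator (ψLeft k)
  ψRight_gen : ∀ k < N, IsGenerator (ψRight k)
  basis : HilbertBasis (WIndex J) ℝ L2I
  basis_scaling : ∀ k : Fin (2 ^ J),
    (basis (Sum.inl k) : ℝ → ℝ) =ᵐ[volume.restrict (Set.Icc (0 : ℝ) 1)]
      dilatedFun N φ φLeft φRight J k
  basis_wavelet : ∀ (m : ℕ) (k : Fin (2 ^ (J + m))),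
    (basis (Sum.inr ⟨m, k⟩) : ℝ → ℝ) =ᵐ[volume.restrict (Set.Icc (0 : ℝ) 1)]
      dilatedFun N ψ ψLeft ψRight (J + m) k

/-- The Hölder-type ball `H^β(L)`: all `f` with `|f_{lk}| ≤ 2^{-l(1/2+β)} L` for all `l, k`, where
`f_{lk} = ⟨f, ψ_{lk}⟩`. -/
def holderBall (W : BoundaryCorrectedWaveletBasis) (β L : ℝ) : Set L2I :=
  {f | ∀ i : WIndex W.J,
    |inner ℝ f (W.basis i)| ≤ (2 : ℝ) ^ (-(WIndex.level i : ℝ) * (1 / 2 + β)) * L}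

/-- The conditions on the heavy-tailed probability density `h`: it is symmetric, positive, bounded,
decreasing on `[0,∞)`, and `log (1/h(x)) ≤ c₁ (1 + log^{1+κ}(1+x))` for `x ≥ 0`. -/
structure IsHeavyTailedDensity (h : ℝ → ℝ) (κ c₁ : ℝ) : Prop where
  measurable : Measurable h
  integral_eq_one : ∫ x, h x = 1
  symmetric : ∀ x, h (-x) = h x
  pos : ∀ x, 0 < h x
  bounded : ∃ C : ℝ, ∀ x, h x ≤ C
  decreasing : AntitoneOn h (Set.Ici 0)
  log_le : ∀ x : ℝ, 0 ≤ x →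
    Real.log (1 / h x) ≤ c₁ * (1 + Real.log (1 + x) ^ (1 + κ))

/-- The scaling `s_l = 2^{-l(1/2+α)}`. -/
def scaleHT (α : ℝ) (l : ℕ) : ℝ := (2 : ℝ) ^ (-(l : ℝ) * (1 / 2 + α))

/-- The scaling `s_l = 2^{-l²}`. -/
def scaleOT (l : ℕ) : ℝ := (2 : ℝ) ^ (-((l : ℝ) ^ 2))

/-- The joint law of the independent coefficients `f_{lk} = s_l ζ_{lk}`, the `ζ_{lk}` being
independent and identically distributed with density `h`. -/
def coefLaw (J : ℕ) (s : ℕ → ℝ) (h : ℝ → ℝ) : Measure (WIndex J → ℝ) :=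
  Measure.infinitePi fun i : WIndex J =>
    (volume.withDensity fun z => ENNReal.ofReal (h z)).map fun z => s (WIndex.level i) * z

/-- The function `∑_{l,k} f_{lk} ψ_{lk}` with given coefficients, as a series in `L²[0,1]`. -/
def waveletSeries (W : BoundaryCorrectedWaveletBasis) (x : WIndex W.J → ℝ) : L2I :=
  ∑' i, x i • W.basis i

/-- The heavy-tailed wavelet series prior: the law on `L²[0,1]` of the random function
`f = ∑_{l,k} s_l ζ_{lk} ψ_{lk}`. -/
def waveletPrior (W : BoundaryCorrectedWaveletBasis) (s : ℕ → ℝ) (h : ℝ → ℝ) : Measure L2I :=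
  (coefLaw W.J s h).map (waveletSeries W)

/-- The rate
`(log log n)^{2/(1+2β)} (log n)^{(1+(1+κ)β)/(1+2β)} n^{-β/(2β+1)}`. -/
def rateHT (κ β : ℝ) (n : ℕ) : ℝ :=
  Real.log (Real.log n) ^ (2 / (1 + 2 * β)) *
    Real.log n ^ ((1 + (1 + κ) * β) / (1 + 2 * β)) * (n : ℝ) ^ (-(β / (2 * β + 1)))

/-- The rate `(log n)^{(2+2κ)β/(1+2β)} n^{-β/(2β+1)}`. -/
def rateOT (κ β : ℝ) (n : ℕ) : ℝ :=
  Real.log n ^ ((2 + 2 * κ) * β / (1 + 2 * β)) * (n : ℝ) ^ (-(β / (2 * β + 1)))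

end

/-! Fix a cutoff level `L` and consider the event `coefBox` that every coefficient at levels `l ≤ L`
is within `2^{-L(1/2+β)}` of that of `f₀`, while every coefficient at levels `l > L` is small, with
a bound decaying slightly faster than `2^{-l/2}`.

On this event the sup norm of `f - f₀` is `O(2^{-Lβ})`. Indeed boundedly many basis functions of
each kind and level are nonzero at a given point, so coefficients of size `A l` at level `l` cost
`2^{l/2} A l` in sup norm (`BoundaryCorrectedWaveletBasis.exists_supNorm_le`), and the sum is
geometric on both sides of `L`.

The event has probability at least `exp (-K 2^L L^q)`, `q = p(1+κ)`, by independence. If `log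
(1/s_l)` is `O((1+l)^p)`, a low-level `ζ` must hit an interval at distance at most `exp (O(L^p))`;
thanks to the heavy tail of `h` this costs only `O(L^q)` in the exponent, and there are `O(2^L)`
such coefficients. At a level `l > L` each `ζ` may be as large as `2^{(l-L)(α+1/2)/2}`; by the
second-order tail bound this costs `O(2^{-(l-L)(α+1/2)})`, and since `α > 1/2` the total over all
high levels is only `O(2^L)`.

Taking `2^L` of order `c (n / (log n)^q)^{1/(1+2β)}` balances `n` times the squared radius with the
cost. A small `c` achieves any `d₂`, at the price of a large `d₁`. The two scalings correspond to `p
= 1` and `p = 2`. -/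

/-! ### Sup norm bounds from wavelet coefficients. -/

theorem card_filter_abs_sub_le (y : ℝ) {R : ℝ} (hR : 0 ≤ R) (s : Finset ℕ) :
    ((s.filter fun k : ℕ => |y - k| ≤ R).card : ℝ) ≤ 2 * R + 1 := by
  have h1 : (s.filter fun k : ℕ => |y - k| ≤ R).card ≤ (Finset.Icc ⌈y - R⌉ ⌊y + R⌋).card := by
    refine Finset.card_le_card_of_injOn (fun k : ℕ => (k : ℤ)) ?_ ?_
    · intro k hk
      have hk' := (Finset.mem_filter.1 hk).2
      rw [abs_le] at hk'
      simp only [Finset.coe_Icc, Set.mem_Icc, Int.ceil_le, Int.le_floor, Int.cast_natCast]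
      constructor <;> linarith [hk'.1, hk'.2]
    · intro a _ b _ hab
      exact Int.ofNat_inj.1 hab
  rw [Int.card_Icc] at h1
  have h2 : ((⌊y + R⌋ + 1 - ⌈y - R⌉).toNat : ℝ) ≤ 2 * R + 1 := by
    rcases le_or_gt 0 (⌊y + R⌋ + 1 - ⌈y - R⌉) with h | h
    · have : (((⌊y + R⌋ + 1 - ⌈y - R⌉).toNat : ℤ) : ℝ) = ((⌊y + R⌋ + 1 - ⌈y - R⌉ : ℤ) : ℝ) := by
        rw [Int.toNat_of_nonneg h]
      rw [Int.cast_natCast] at this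
      rw [this]
      push_cast
      linarith [Int.floor_le (y + R), Int.le_ceil (y - R)]
    · rw [Int.toNat_of_nonpos h.le]
      simp only [Nat.cast_zero]
      linarith
  exact le_trans (by exact_mod_cast h1) h2

theorem IsGenerator.exists_sum_translates_le {g : ℝ → ℝ} (hg : IsGenerator g) :
    ∃ C : ℝ, 0 ≤ C ∧ ∀ (y : ℝ) (s : Finset ℕ), ∑ k ∈ s, |g (y - k)| ≤ C := by
  obtain ⟨M, hM⟩ := hg.bounded
  have hM0 : 0 ≤ M := (abs_nonneg _).trans (hM 0)
  obtain ⟨R, hR⟩ := hg.compactSupport.isCompact.isBounded.exists_norm_le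
  have hR' : ∀ x, |R| < |x| → g x = 0 := by
    intro x hx
    by_contra h
    exact absurd ((hR x (subset_tsupport _ h)).trans (le_abs_self R)) (not_le.2 hx)
  refine ⟨(2 * |R| + 1) * M, by positivity, fun y s => ?_⟩
  calc ∑ k ∈ s, |g (y - k)|
      ≤ ∑ k ∈ s, if |y - k| ≤ |R| then M else 0 := by
        refine Finset.sum_le_sum fun k _ => ?_
        split_ifs with h
        · exact hM _
        · rw [hR' _ (not_le.1 h), abs_zero]
    _ = ((s.filter fun k : ℕ => |y - k| ≤ |R|).card : ℝ) * M := by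
        rw [← Finset.sum_filter, Finset.sum_const, nsmul_eq_mul]
    _ ≤ _ := mul_le_mul_of_nonneg_right (card_filter_abs_sub_le y (abs_nonneg R) s) hM0

theorem exists_uniform_bound {N : ℕ} {g : ℕ → ℝ → ℝ} (hg : ∀ k < N, IsGenerator (g k)) :
    ∃ M : ℝ, 0 ≤ M ∧ ∀ k < N, ∀ x, |g k x| ≤ M := by
  induction N with
  | zero => exact ⟨0, le_rfl, fun k hk => absurd hk (Nat.not_lt_zero k)⟩
  | succ N ih =>
    obtain ⟨M, hM0, hM⟩ := ih fun k hk => hg k (hk.trans (Nat.lt_succ_self N))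
    obtain ⟨M', hM'⟩ := (hg N (Nat.lt_succ_self N)).bounded
    refine ⟨max M M', hM0.trans (le_max_left _ _), fun k hk x => ?_⟩
    rcases Nat.lt_succ_iff_lt_or_eq.1 hk with h | rfl
    · exact (hM k h x).trans (le_max_left _ _)
    · exact (hM' x).trans (le_max_right _ _)

theorem sum_ite_lt_le {N : ℕ} {M : ℝ} (hM : 0 ≤ M) (n : ℕ) :
    ∑ k ∈ Finset.range n, (if k < N then M else 0) ≤ N * M := by
  rw [← Finset.sum_filter, Finset.sum_const, nsmul_eq_mul]
  refine mul_le_mul_of_nonneg_right ?_ hM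
  have : ((Finset.range n).filter fun k => k < N) ⊆ Finset.range N := fun k hk =>
    Finset.mem_range.2 (Finset.mem_filter.1 hk).2
  exact_mod_cast (Finset.card_le_card this).trans_eq (Finset.card_range N)

/-- Bounded overlap: compact support limits the interior translates that meet a point, and there are
at most `N` functions at each edge, so only the factor `2^{l/2}` depends on the level. -/
theorem exists_sum_dilatedFun_le {N : ℕ} {g : ℝ → ℝ} {gl gr : ℕ → ℝ → ℝ} (hg : IsGenerator g)
    (hl : ∀ k < N, IsGenerator (gl k)) (hr : ∀ k < N, IsGenerator (gr k)) :
    ∃ C : ℝ, 0 ≤ C ∧ ∀ (l : ℕ) (x : ℝ),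
      ∑ k ∈ Finset.range (2 ^ l), |dilatedFun N g gl gr l k x| ≤ C * (2 : ℝ) ^ ((l : ℝ) / 2) := by
  obtain ⟨C, hC0, hC⟩ := hg.exists_sum_translates_le
  obtain ⟨Ml, hMl0, hMl⟩ := exists_uniform_bound hl
  obtain ⟨Mr, hMr0, hMr⟩ := exists_uniform_bound hr
  refine ⟨N * Ml + C + N * Mr, by positivity, fun l x => ?_⟩
  have key : ∀ k ∈ Finset.range (2 ^ l), |dilatedFun N g gl gr l k x| ≤ (2 : ℝ) ^ ((l : ℝ) / 2) *
      ((if k < N then Ml else 0) + |g (2 ^ l * x - k)| +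
        (if 2 ^ l - 1 - k < N then Mr else 0)) := by
    intro k hk
    have hk' := Finset.mem_range.1 hk
    unfold dilatedFun
    rw [abs_mul, abs_of_nonneg (by positivity : (0 : ℝ) ≤ (2 : ℝ) ^ ((l : ℝ) / 2))]
    refine mul_le_mul_of_nonneg_left ?_ (by positivity)
    have h1 : (0 : ℝ) ≤ if k < N then Ml else 0 := by split_ifs <;> simp [hMl0]
    have h2 : (0 : ℝ) ≤ if 2 ^ l - 1 - k < N then Mr else 0 := by split_ifs <;> simp [hMr0]
    have h3 := abs_nonneg (g (2 ^ l * x - k))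
    by_cases ha : k < N
    · simp only [ha, if_true] at h1 ⊢
      linarith [hMl k ha (2 ^ l * x)]
    · by_cases hb : k < 2 ^ l - N
      · simp only [ha, hb, if_true, if_false] at h1 ⊢
        linarith
      · have hc : 2 ^ l - 1 - k < N := by omega
        simp only [ha, hb, hc, if_true, if_false] at h1 ⊢
        linarith [hMr _ hc (2 ^ l * (x - 1))]
  calc _ ≤ _ := Finset.sum_le_sum key
    _ = (2 : ℝ) ^ ((l : ℝ) / 2) * (∑ k ∈ Finset.range (2 ^ l), (if k < N then Ml else 0) +
          ∑ k ∈ Finset.range (2 ^ l), |g (2 ^ l * x - k)| +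
          ∑ k ∈ Finset.range (2 ^ l), (if 2 ^ l - 1 - k < N then Mr else 0)) := by
        rw [← Finset.mul_sum, Finset.sum_add_distrib, Finset.sum_add_distrib]
    _ ≤ (2 : ℝ) ^ ((l : ℝ) / 2) * (N * Ml + C + N * Mr) := by
        refine mul_le_mul_of_nonneg_left ?_ (by positivity)
        -- Right edge functions are numbered from the right end, so reversing the sum reduces them
        -- to the left edge count.
        have hrefl := Finset.sum_range_reflect (fun j : ℕ => if j < N then Mr else 0) (2 ^ l)
        rw [hrefl]
        exact add_le_add (add_le_add (sum_ite_lt_le hMl0 _) (hC _ _)) (sum_ite_lt_le hMr0 _)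
    _ = _ := mul_comm _ _

/-- Summing over all indices a bound that depends on the level only. -/
theorem sum_level_le {J : ℕ} {a : WIndex J → ℝ} {B : ℕ → ℝ} (ha : ∀ i, 0 ≤ a i) (hB : Summable B)
    (hB0 : ∀ l, 0 ≤ B l)
    (h1 : ∑ k, a (Sum.inl k) ≤ B J)
    (h2 : ∀ m, ∑ k, a (Sum.inr ⟨m, k⟩) ≤ B (J + m)) (F : Finset (WIndex J)) :
    ∑ i ∈ F, a i ≤ 2 * ∑' l, B l := by
  classical
  have hsig : ∀ G : Finset (Σ m : ℕ, Fin (2 ^ (J + m))), ∑ p ∈ G, a (Sum.inr p) ≤ ∑' l, B l := by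
    intro G
    calc ∑ p ∈ G, a (Sum.inr p)
        ≤ ∑ p ∈ (G.image Sigma.fst).sigma fun m => (Finset.univ : Finset (Fin (2 ^ (J + m)))),
            a (Sum.inr p) :=
          Finset.sum_le_sum_of_subset_of_nonneg
            (fun p hp => Finset.mem_sigma.2 ⟨Finset.mem_image_of_mem _ hp, Finset.mem_univ _⟩)
            fun _ _ _ => ha _
      _ = ∑ m ∈ G.image Sigma.fst, ∑ k, a (Sum.inr ⟨m, k⟩) := by rw [Finset.sum_sigma]
      _ ≤ ∑ m ∈ G.image Sigma.fst, B (J + m) := Finset.sum_le_sum fun m _ => h2 m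
      _ = ∑ l ∈ (G.image Sigma.fst).image (J + ·), B l := by
          rw [Finset.sum_image fun _ _ _ _ h => Nat.add_left_cancel h]
      _ ≤ _ := hB.sum_le_tsum _ fun _ _ => hB0 _
  calc ∑ i ∈ F, a i ≤ ∑ i ∈ F.toLeft.disjSum F.toRight, a i := by rw [Finset.toLeft_disjSum_toRight]
    _ = ∑ k ∈ F.toLeft, a (Sum.inl k) + ∑ p ∈ F.toRight, a (Sum.inr p) := Finset.sum_disjSum _ _ _
    _ ≤ ∑' l, B l + ∑' l, B l := by
        refine add_le_add ?_ (hsig _)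
        -- The scaling functions share level `J` with the first wavelets; a second copy of the
        -- series pays for them, whence the factor 2.
        refine (Finset.sum_le_sum_of_subset_of_nonneg (Finset.subset_univ _) fun _ _ _ => ha _).trans
          (h1.trans (hB.le_tsum J fun _ _ => hB0 _))
    _ = _ := (two_mul _).symm

/-- The order of `L²` is closed, so the interval `[-B, B]` survives the limit although convergence
holds only in `L²`. -/
theorem supNorm_le_of_hasSum {ι : Type*} {g : ι → L2I} {f : L2I} (hf : HasSum g f) {B : ℝ}
    (hg : ∀ F : Finset ι,
      ∀ᵐ x ∂(volume.restrict (Set.Icc (0 : ℝ) 1)), |(∑ i ∈ F, g i : L2I) x| ≤ B) :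
    supNorm f ≤ ENNReal.ofReal B := by
  let c : L2I := (memLp_const B).toLp _
  have hc : c =ᵐ[volume.restrict (Set.Icc (0 : ℝ) 1)] fun _ => B := MemLp.coeFn_toLp _
  have h1 : f ≤ c := le_of_tendsto hf <| Eventually.of_forall fun F => by
    rw [← Lp.coeFn_le]
    filter_upwards [hc, hg F] with x hx hy
    rw [hx]
    exact (abs_le.1 hy).2
  have h2 : -c ≤ f := ge_of_tendsto hf <| Eventually.of_forall fun F => by
    rw [← Lp.coeFn_le]
    filter_upwards [hc, hg F, Lp.coeFn_neg c] with x hx hy hz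
    rw [hz, Pi.neg_apply, hx]
    exact (abs_le.1 hy).1
  rw [← Lp.coeFn_le] at h1 h2
  unfold supNorm
  refine (eLpNorm_le_of_ae_bound (C := B) ?_).trans (by simp)
  filter_upwards [h1, h2, hc, Lp.coeFn_neg c] with x a b hx hz
  rw [hz, Pi.neg_apply, hx] at b
  rw [hx] at a
  exact abs_le.2 ⟨b, a⟩

theorem BoundaryCorrectedWaveletBasis.exists_supNorm_le (W : BoundaryCorrectedWaveletBasis) :
    ∃ C : ℝ, 0 ≤ C ∧ ∀ (f : L2I) (A : ℕ → ℝ), (∀ l, 0 ≤ A l) →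
      (∀ i, |inner ℝ f (W.basis i)| ≤ A (WIndex.level i)) →
      (Summable fun l : ℕ => (2 : ℝ) ^ ((l : ℝ) / 2) * A l) →
      supNorm f ≤ ENNReal.ofReal (C * ∑' l : ℕ, (2 : ℝ) ^ ((l : ℝ) / 2) * A l) := by
  obtain ⟨C₁, hC₁, h₁⟩ := exists_sum_dilatedFun_le W.φ_gen W.φLeft_gen W.φRight_gen
  obtain ⟨C₂, hC₂, h₂⟩ := exists_sum_dilatedFun_le W.ψ_gen W.ψLeft_gen W.ψRight_gen
  refine ⟨2 * max C₁ C₂, by positivity, fun f A hA hfA hsum => ?_⟩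
  have hs := W.basis.hasSum_repr f
  refine supNorm_le_of_hasSum hs fun F => ?_
  have hsc : ∀ᵐ x ∂(volume.restrict (Set.Icc (0 : ℝ) 1)), ∀ k : Fin (2 ^ W.J),
      W.basis (Sum.inl k) x = dilatedFun W.N W.φ W.φLeft W.φRight W.J k x :=
    ae_all_iff.2 W.basis_scaling
  have hwv : ∀ᵐ x ∂(volume.restrict (Set.Icc (0 : ℝ) 1)), ∀ (m : ℕ) (k : Fin (2 ^ (W.J + m))),
      W.basis (Sum.inr ⟨m, k⟩) x = dilatedFun W.N W.ψ W.ψLeft W.ψRight (W.J + m) k x :=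
    ae_all_iff.2 fun m => ae_all_iff.2 (W.basis_wavelet m)
  have hsmul : ∀ᵐ x ∂(volume.restrict (Set.Icc (0 : ℝ) 1)), ∀ i,
      (W.basis.repr f i • W.basis i : L2I) x = W.basis.repr f i * W.basis i x :=
    ae_all_iff.2 fun i => Lp.coeFn_smul _ _
  filter_upwards [hsc, hwv, hsmul, Lp.coeFn_finsetSum F fun i => (W.basis.repr f i • W.basis i : L2I)]
    with x hx1 hx2 hx3 hx4
  rw [hx4, Finset.sum_apply]
  simp only [hx3]
  refine (Finset.abs_sum_le_sum_abs _ _).trans ?_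
  have hco : ∀ i, |W.basis.repr f i| ≤ A (WIndex.level i) := fun i => by
    rw [W.basis.repr_apply_apply, real_inner_comm]
    exact hfA i
  have hsum' : Summable fun l : ℕ => max C₁ C₂ * ((2 : ℝ) ^ ((l : ℝ) / 2) * A l) :=
    hsum.mul_left _
  refine (sum_level_le (fun i => abs_nonneg _) hsum'
    (fun l => mul_nonneg (by positivity) (mul_nonneg (by positivity) (hA l))) ?_ ?_ F).trans_eq ?_
  · calc _ ≤ ∑ k : Fin (2 ^ W.J), A W.J * |dilatedFun W.N W.φ W.φLeft W.φRight W.J k x| := by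
          refine Finset.sum_le_sum fun k _ => ?_
          rw [abs_mul, hx1 k]
          exact mul_le_mul_of_nonneg_right (hco (Sum.inl k)) (abs_nonneg _)
      _ = A W.J * ∑ k ∈ Finset.range (2 ^ W.J),
            |dilatedFun W.N W.φ W.φLeft W.φRight W.J k x| := by
          rw [← Finset.mul_sum, Fin.sum_univ_eq_sum_range
            (fun k => |dilatedFun W.N W.φ W.φLeft W.φRight W.J k x|)]
      _ ≤ A W.J * (max C₁ C₂ * (2 : ℝ) ^ ((W.J : ℝ) / 2)) :=
          mul_le_mul_of_nonneg_left ((h₁ _ _).trans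
            (mul_le_mul_of_nonneg_right (le_max_left _ _) (by positivity))) (hA _)
      _ = _ := by ring
  · intro m
    calc _ ≤ ∑ k : Fin (2 ^ (W.J + m)),
            A (W.J + m) * |dilatedFun W.N W.ψ W.ψLeft W.ψRight (W.J + m) k x| := by
          refine Finset.sum_le_sum fun k _ => ?_
          rw [abs_mul, hx2 m k]
          exact mul_le_mul_of_nonneg_right (hco (Sum.inr ⟨m, k⟩)) (abs_nonneg _)
      _ = A (W.J + m) * ∑ k ∈ Finset.range (2 ^ (W.J + m)),
            |dilatedFun W.N W.ψ W.ψLeft W.ψRight (W.J + m) k x| := by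
          rw [← Finset.mul_sum, Fin.sum_univ_eq_sum_range
            (fun k => |dilatedFun W.N W.ψ W.ψLeft W.ψRight (W.J + m) k x|)]
      _ ≤ A (W.J + m) * (max C₁ C₂ * (2 : ℝ) ^ (((W.J + m : ℕ) : ℝ) / 2)) :=
          mul_le_mul_of_nonneg_left ((h₂ _ _).trans
            (mul_le_mul_of_nonneg_right (le_max_right _ _) (by positivity))) (hA _)
      _ = _ := by ring
  · rw [tsum_mul_left]
    ring

/-! ### Sums of functions of the level. -/

theorem two_rpow_level_mul (a : ℝ) (l : ℕ) : (2 : ℝ) ^ ((l : ℝ) * a) = ((2 : ℝ) ^ a) ^ l := by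
  rw [mul_comm, Real.rpow_mul_natCast zero_le_two]

theorem summable_two_rpow_level_mul {a : ℝ} (ha : a < 0) :
    Summable fun l : ℕ => (2 : ℝ) ^ ((l : ℝ) * a) := by
  simp only [two_rpow_level_mul]
  exact summable_geometric_of_lt_one (by positivity) (Real.rpow_lt_one_of_one_lt_of_neg one_lt_two ha)

/-- Summing a function of the level over all indices. -/
theorem sum_comp_level_le {J : ℕ} {e : ℕ → ℝ} (he : ∀ l, 0 ≤ e l)
    (hs : Summable fun l : ℕ => (2 : ℝ) ^ l * e l) (F : Finset (WIndex J)) :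
    ∑ i ∈ F, e (WIndex.level i) ≤ 2 * ∑' l : ℕ, (2 : ℝ) ^ l * e l :=
  sum_level_le (a := fun i => e (WIndex.level i)) (fun _ => he _) hs
    (fun l => mul_nonneg (by positivity) (he l)) (by simp [WIndex.level]) (by simp [WIndex.level]) F

theorem summable_comp_level {J : ℕ} {e : ℕ → ℝ} (he : ∀ l, 0 ≤ e l)
    (hs : Summable fun l : ℕ => (2 : ℝ) ^ l * e l) :
    Summable fun i : WIndex J => e (WIndex.level i) :=
  summable_of_sum_le (fun _ => he _) (sum_comp_level_le he hs)

theorem summable_two_rpow_level {J : ℕ} {a : ℝ} (ha : a < -1) :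
    Summable fun i : WIndex J => (2 : ℝ) ^ ((WIndex.level i : ℝ) * a) := by
  refine summable_comp_level (e := fun l => (2 : ℝ) ^ ((l : ℝ) * a)) (fun l => by positivity) ?_
  refine (summable_two_rpow_level_mul (a := 1 + a) (by linarith)).congr fun l => ?_
  rw [mul_add, mul_one, Real.rpow_add two_pos, Real.rpow_natCast]

/-! ### The law of a single variable: tails and intervals. -/

/-- The probability measure with density `h`. -/
noncomputable def densityLaw (h : ℝ → ℝ) : Measure ℝ :=
  volume.withDensity fun z => ENNReal.ofReal (h z)

namespace IsHeavyTailedDensity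

variable {h : ℝ → ℝ} {κ c₁ : ℝ}

theorem integrable (hh : IsHeavyTailedDensity h κ c₁) : Integrable h := by
  by_contra hn
  have := hh.integral_eq_one
  rw [integral_undef hn] at this
  exact zero_ne_one this

theorem isProbabilityMeasure (hh : IsHeavyTailedDensity h κ c₁) :
    IsProbabilityMeasure (densityLaw h) := by
  constructor
  rw [densityLaw, withDensity_apply _ MeasurableSet.univ, setLIntegral_univ,
    ← ofReal_integral_eq_lintegral_ofReal hh.integrable (ae_of_all _ fun z => (hh.pos z).le),
    hh.integral_eq_one, ENNReal.ofReal_one]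

theorem densityLaw_Ioi (hh : IsHeavyTailedDensity h κ c₁) (t : ℝ) :
    densityLaw h (Set.Ioi t) = ENNReal.ofReal (∫ u in Set.Ioi t, h u) := by
  rw [densityLaw, withDensity_apply _ measurableSet_Ioi,
    ofReal_integral_eq_lintegral_ofReal hh.integrable.integrableOn
      (ae_of_all _ fun z => (hh.pos z).le)]

theorem densityLaw_Iio_neg (hh : IsHeavyTailedDensity h κ c₁) (t : ℝ) :
    densityLaw h (Set.Iio (-t)) = densityLaw h (Set.Ioi t) := by
  rw [densityLaw, withDensity_apply _ measurableSet_Ioi, withDensity_apply _ measurableSet_Iio]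
  have := (Measure.measurePreserving_neg (volume : Measure ℝ)).setLIntegral_comp_preimage
    (measurableSet_Iio (a := -t)) hh.measurable.ennreal_ofReal
  rw [← this]
  have hset : (Neg.neg : ℝ → ℝ) ⁻¹' Set.Iio (-t) = Set.Ioi t := by
    ext x
    simp
  rw [hset]
  simp only [hh.symmetric]

theorem densityLaw_tail_le (hh : IsHeavyTailedDensity h κ c₁) {c₂ : ℝ}
    (htail : ∀ x : ℝ, 1 ≤ x → ∫ u in Set.Ioi x, h u ≤ c₂ / x ^ 2) {t : ℝ} (ht : 1 ≤ t) :
    densityLaw h {z | t < |z|} ≤ ENNReal.ofReal (2 * c₂ / t ^ 2) := by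
  have hset : {z : ℝ | t < |z|} = Set.Iio (-t) ∪ Set.Ioi t := by
    ext z
    simp only [Set.mem_ofPred_eq, Set.mem_union, Set.mem_Iio, Set.mem_Ioi, lt_abs]
    rw [lt_neg, or_comm]
  have h0 : 0 ≤ ∫ u in Set.Ioi t, h u := integral_nonneg fun z => (hh.pos z).le
  rw [hset]
  refine (measure_union_le _ _).trans ?_
  rw [hh.densityLaw_Iio_neg, hh.densityLaw_Ioi, ← ENNReal.ofReal_add h0 h0]
  refine ENNReal.ofReal_le_ofReal ?_
  have := htail t ht
  rw [mul_div_assoc]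
  linarith

/-- The interval lies in `[-b, b]`, where the symmetric density, decreasing in `|z|`, is at least `h
b`. -/
theorem le_densityLaw_ball (hh : IsHeavyTailedDensity h κ c₁) (a : ℝ) {r b : ℝ} (hr : 0 ≤ r)
    (hb : |a| + r ≤ b) :
    ENNReal.ofReal (2 * r * h b) ≤ densityLaw h {z | |z - a| ≤ r} := by
  have hset : {z : ℝ | |z - a| ≤ r} = Set.Icc (a - r) (a + r) := by
    ext z
    simp only [Set.mem_ofPred_eq, Set.mem_Icc, abs_le]
    constructor <;> rintro ⟨h1, h2⟩ <;> constructor <;> linarith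
  rw [hset, densityLaw, withDensity_apply _ measurableSet_Icc]
  calc ENNReal.ofReal (2 * r * h b)
      = ∫⁻ _ in Set.Icc (a - r) (a + r), ENNReal.ofReal (h b) := by
        rw [setLIntegral_const, Real.volume_Icc, ENNReal.ofReal_mul (by linarith), mul_comm]
        ring_nf
    _ ≤ _ := by
        refine setLIntegral_mono hh.measurable.ennreal_ofReal fun z hz => ?_
        refine ENNReal.ofReal_le_ofReal ?_
        have habs : h |z| = h z := by
          rcases abs_choice z with h1 | h1 <;> rw [h1]
          exact hh.symmetric z
        rw [← habs]
        have h1 : |z| ≤ b := by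
          refine le_trans ?_ hb
          have : |z - a| ≤ r := by
            rw [abs_le]
            constructor <;> linarith [hz.1, hz.2]
          have h3 : |z| ≤ |z - a| + |a| := by
            simpa using abs_add_le (z - a) a
          linarith
        exact hh.decreasing (abs_nonneg z) ((abs_nonneg z).trans h1) h1

end IsHeavyTailedDensity

/-! ### The product law and almost sure convergence of the series. -/

/-- All factors are at most 1, so the infinite product is the infimum of its finite subproducts, and
a uniform bound on the finite sums of the costs `e` suffices. -/
theorem le_infinitePi_box {ι : Type*} [Countable ι] (μ : ι → Measure ℝ)
    [∀ i, IsProbabilityMeasure (μ i)] {t : ι → Set ℝ} (mt : ∀ i, MeasurableSet (t i)) {e : ι → ℝ}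
    {E : ℝ} (hE : ∀ F : Finset ι, ∑ i ∈ F, e i ≤ E)
    (he : ∀ i, ENNReal.ofReal (Real.exp (-e i)) ≤ μ i (t i)) :
    ENNReal.ofReal (Real.exp (-E)) ≤ Measure.infinitePi μ {x | ∀ i, x i ∈ t i} := by
  have hset : {x : ι → ℝ | ∀ i, x i ∈ t i} = Set.univ.pi t := by
    ext x
    simp
  rw [hset, Measure.infinitePi_pi_univ _ mt, ENNReal.tprod_eq_iInf_prod fun i => prob_le_one]
  refine le_iInf fun F => ?_
  calc ENNReal.ofReal (Real.exp (-E)) ≤ ENNReal.ofReal (∏ i ∈ F, Real.exp (-e i)) := by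
        refine ENNReal.ofReal_le_ofReal ?_
        rw [← Real.exp_sum, Real.exp_le_exp, Finset.sum_neg_distrib]
        exact neg_le_neg (hE F)
    _ = ∏ i ∈ F, ENNReal.ofReal (Real.exp (-e i)) :=
        ENNReal.ofReal_prod_of_nonneg fun _ _ => (Real.exp_pos _).le
    _ ≤ _ := Finset.prod_le_prod' fun i _ => he i

theorem isProbabilityMeasure_map_mul {h : ℝ → ℝ} {κ c₁ : ℝ} (hh : IsHeavyTailedDensity h κ c₁)
    (s : ℝ) : IsProbabilityMeasure ((densityLaw h).map fun z => s * z) :=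
  haveI := hh.isProbabilityMeasure
  Measure.isProbabilityMeasure_map (by fun_prop)

theorem coefLaw_eval {J : ℕ} {s : ℕ → ℝ} {h : ℝ → ℝ} {κ c₁ : ℝ}
    (hh : IsHeavyTailedDensity h κ c₁) (i : WIndex J) {B : Set ℝ} (hB : MeasurableSet B) :
    coefLaw J s h {x | x i ∈ B} = densityLaw h {z | s (WIndex.level i) * z ∈ B} := by
  have : ∀ i : WIndex J, IsProbabilityMeasure
      ((densityLaw h).map fun z => s (WIndex.level i) * z) :=
    fun i => isProbabilityMeasure_map_mul hh _
  have h1 := (measurePreserving_eval_infinitePi (fun i : WIndex J =>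
    (densityLaw h).map fun z => s (WIndex.level i) * z) i).measure_preimage hB.nullMeasurableSet
  rw [Measure.map_apply (by fun_prop) hB] at h1
  exact h1

theorem HilbertBasis.summable_smul_of_sq {ι E : Type*} [NormedAddCommGroup E]
    [InnerProductSpace ℝ E] (b : HilbertBasis ι ℝ E) {x : ι → ℝ} (hx : Summable fun i => x i ^ 2) :
    Summable fun i => x i • b i := by
  have hm : Memℓp x 2 := memℓp_gen (by simpa using hx)
  exact (b.hasSum_repr_symm ⟨x, hm⟩).summable

theorem HilbertBasis.inner_tsum_smul {ι E : Type*} [NormedAddCommGroup E]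
    [InnerProductSpace ℝ E] (b : HilbertBasis ι ℝ E) {x : ι → ℝ} (hx : Summable fun i => x i • b i)
    (j : ι) : inner ℝ (∑' i, x i • b i) (b j) = x j := by
  classical
  have h1 := hx.hasSum.mapL (innerSL ℝ (b j))
  have h2 : HasSum (fun i => innerSL ℝ (b j) (x i • b i)) (x j) := by
    have h3 : ∀ i, innerSL ℝ (b j) (x i • b i) = if i = j then x j else 0 := by
      intro i
      rw [innerSL_apply_apply, real_inner_smul_right, orthonormal_iff_ite.1 b.orthonormal j i]
      by_cases hij : i = j
      · subst hij
        simp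
      · simp [hij, Ne.symm hij]
    simp only [h3]
    exact hasSum_ite_eq j (x j)
  have := h1.unique h2
  rwa [innerSL_apply_apply, real_inner_comm] at this

/-- Borel–Cantelli: almost surely all but finitely many `ζ` are at most `t l`, after which the
coefficients are square summable. -/
theorem ae_summable_series (W : BoundaryCorrectedWaveletBasis) {h : ℝ → ℝ} {κ c₁ c₂ : ℝ}
    (hh : IsHeavyTailedDensity h κ c₁)
    (htail : ∀ x : ℝ, 1 ≤ x → ∫ u in Set.Ioi x, h u ≤ c₂ / x ^ 2) {s : ℕ → ℝ} {C α : ℝ}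
    (hα : 1 / 2 < α) (hs0 : ∀ l, 0 < s l) (hs : ∀ l, s l ≤ C * scaleHT α l) :
    ∀ᵐ x ∂(coefLaw W.J s h), Summable fun i => x i • W.basis i := by
  -- Any `η > 0` makes the tail probabilities `2^{-l(1+2η)}` summable over the indices; this one
  -- turns `(s_l t_l)^2` into `O(2^{-l(α+1/2)})`, summable as well because `α > 1/2`.
  set η : ℝ := (α - 1 / 2) / 2 with hη
  have hη0 : 0 < η := by rw [hη]; linarith
  let t : ℕ → ℝ := fun l => (2 : ℝ) ^ ((l : ℝ) * (1 / 2 + η))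
  have ht0 : ∀ l, 0 < t l := fun l => by positivity
  have ht1 : ∀ l, 1 ≤ t l := fun l =>
    Real.one_le_rpow one_le_two (by positivity)
  have hbad : ∀ i : WIndex W.J,
      coefLaw W.J s h {x | x i ∈ {y | s (WIndex.level i) * t (WIndex.level i) < |y|}} ≤
        ENNReal.ofReal (2 * c₂ * (2 : ℝ) ^ ((WIndex.level i : ℝ) * (-(1 + 2 * η)))) := by
    intro i
    have hmeas : MeasurableSet {y : ℝ | s (WIndex.level i) * t (WIndex.level i) < |y|} :=
      measurableSet_lt measurable_const measurable_id.abs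
    rw [coefLaw_eval hh i hmeas]
    have hset : {z | s (WIndex.level i) * z ∈ {y | s (WIndex.level i) * t (WIndex.level i) < |y|}}
        = {z | t (WIndex.level i) < |z|} := by
      ext z
      simp only [Set.mem_ofPred_eq, abs_mul, abs_of_pos (hs0 _)]
      exact mul_lt_mul_iff_right₀ (hs0 _)
    rw [hset]
    refine (hh.densityLaw_tail_le htail (ht1 _)).trans_eq ?_
    congr 1
    rw [div_eq_mul_inv]
    congr 1
    simp only [t]
    rw [← Real.rpow_natCast, ← Real.rpow_mul zero_le_two, ← Real.rpow_neg zero_le_two]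
    congr 1
    push_cast
    ring
  have hfin := ae_finite_setOfPred_mem (μ := coefLaw W.J s h)
    (s := fun i : WIndex W.J => {x | x i ∈ {y | s (WIndex.level i) * t (WIndex.level i) < |y|}})
    (ne_top_of_le_ne_top ((summable_two_rpow_level (J := W.J)
      (a := -(1 + 2 * η)) (by linarith)).mul_left (2 * c₂)).tsum_ofReal_ne_top
      (ENNReal.tsum_le_tsum hbad))
  filter_upwards [hfin] with x hx
  refine W.basis.summable_smul_of_sq ?_
  refine Summable.of_norm_bounded_eventually
    ((summable_two_rpow_level (J := W.J) (a := -(α + 1 / 2)) (by linarith)).mul_left (C ^ 2)) ?_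
  filter_upwards [hx.compl_mem_cofinite] with i hi
  simp only [Set.mem_compl_iff, Set.mem_ofPred_eq, not_lt] at hi
  have h1 : |x i| ≤ C * (scaleHT α (WIndex.level i) * t (WIndex.level i)) := by
    rw [← mul_assoc]
    exact hi.trans (mul_le_mul_of_nonneg_right (hs _) (ht0 _).le)
  rw [Real.norm_eq_abs, abs_pow]
  refine (pow_le_pow_left₀ (abs_nonneg _) h1 2).trans_eq ?_
  rw [mul_pow]
  congr 1
  simp only [t, scaleHT]
  rw [← Real.rpow_add two_pos, ← Real.rpow_natCast, ← Real.rpow_mul zero_le_two]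
  congr 1
  rw [hη]
  push_cast
  ring

theorem aemeasurable_waveletSeries (W : BoundaryCorrectedWaveletBasis)
    {μ : Measure (WIndex W.J → ℝ)} (hμ : ∀ᵐ x ∂μ, Summable fun i => x i • W.basis i) :
    AEMeasurable (waveletSeries W) μ := by
  refine aemeasurable_of_tendsto_metrizable_ae (atTop : Filter (Finset (WIndex W.J)))
    (f := fun F x => ∑ i ∈ F, x i • W.basis i) (fun F => ?_) ?_
  · have : Continuous fun x : WIndex W.J → ℝ => ∑ i ∈ F, x i • W.basis i :=
      continuous_finsetSum _ fun i _ => (continuous_apply i).smul continuous_const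
    exact this.measurable.aemeasurable
  · filter_upwards [hμ] with x hx
    exact hx.hasSum

/-- The inequality `Measure.le_map_apply` holds for arbitrary sets, so sup-norm balls need not be
shown measurable in `L²`. -/
theorem le_waveletPrior (W : BoundaryCorrectedWaveletBasis) {s : ℕ → ℝ} {h : ℝ → ℝ}
    (hs : ∀ᵐ x ∂(coefLaw W.J s h), Summable fun i => x i • W.basis i)
    {G : Set (WIndex W.J → ℝ)} {S : Set L2I}
    (hG : ∀ x ∈ G, (Summable fun i => x i • W.basis i) → waveletSeries W x ∈ S) :
    coefLaw W.J s h G ≤ waveletPrior W s h S := by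
  refine le_trans (measure_mono_ae ?_)
    (Measure.le_map_apply (aemeasurable_waveletSeries W hs) S)
  filter_upwards [hs] with x hx hxG
  exact hG x hxG hx

/-! ### Costs of the individual coefficients below and above the cutoff. -/

/-- Growth up to `L` and decay after it make the terms near `L` dominate. It serves both for the
probability cost (`x = 2`) and for the sup norm (`x = 2^{1/2}`). -/
theorem summable_and_tsum_le_of_geometric {a : ℕ → ℝ} {L : ℕ} {x r A B : ℝ} (hx : 1 < x)
    (hr0 : 0 ≤ r) (hr1 : r < 1) (hA : 0 ≤ A) (ha : ∀ l, 0 ≤ a l)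
    (h1 : ∀ l ≤ L, a l ≤ A * x ^ l) (h2 : ∀ m, a (m + (L + 1)) ≤ B * r ^ m) :
    Summable a ∧ ∑' l, a l ≤ A * (x ^ (L + 1) / (x - 1)) + B / (1 - r) := by
  have hg : Summable fun m => B * r ^ m := (summable_geometric_of_lt_one hr0 hr1).mul_left B
  have hs' : Summable fun m => a (m + (L + 1)) := .of_nonneg_of_le (fun _ => ha _) h2 hg
  have hs : Summable a := (summable_nat_add_iff (L + 1)).1 hs'
  refine ⟨hs, ?_⟩
  rw [← hs.sum_add_tsum_nat_add (L + 1)]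
  refine add_le_add ?_ ?_
  · calc ∑ l ∈ Finset.range (L + 1), a l ≤ ∑ l ∈ Finset.range (L + 1), A * x ^ l :=
          Finset.sum_le_sum fun l hl => h1 l (Nat.lt_succ_iff.1 (Finset.mem_range.1 hl))
      _ = A * ((x ^ (L + 1) - 1) / (x - 1)) := by rw [← Finset.mul_sum, geom_sum_eq hx.ne']
      _ ≤ _ := by
          have : 0 < x - 1 := by linarith
          gcongr
          linarith
  · calc ∑' m, a (m + (L + 1)) ≤ ∑' m, B * r ^ m := hs'.tsum_le_tsum h2 hg
      _ = _ := by rw [tsum_mul_left, tsum_geometric_of_lt_one hr0 hr1, div_eq_mul_inv]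

theorem exp_neg_two_mul_le {u : ℝ} (h0 : 0 ≤ u) (h1 : u ≤ 1 / 2) :
    Real.exp (-(2 * u)) ≤ 1 - u := by
  rw [Real.exp_neg]
  refine inv_le_of_inv_le₀ (by linarith) ?_
  refine le_trans ?_ (Real.add_one_le_exp (2 * u))
  rw [inv_le_comm₀ (by linarith) (by linarith), ← one_div, div_le_iff₀ (by linarith)]
  nlinarith

namespace IsHeavyTailedDensity

variable {h : ℝ → ℝ} {κ c₁ : ℝ}

theorem exp_le (hh : IsHeavyTailedDensity h κ c₁) {x : ℝ} (hx : 0 ≤ x) :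
    Real.exp (-(c₁ * (1 + Real.log (1 + x) ^ (1 + κ)))) ≤ h x := by
  rw [← Real.le_log_iff_exp_le (hh.pos x)]
  have := hh.log_le x hx
  rw [one_div, Real.log_inv] at this
  linarith

/-- A coefficient of size `O(1)` at a level `l ≤ L` is approximated to the precision
`2^{-L(1/2+β)}` with probability at least `exp (-K L^{p(1+κ)})`. -/
theorem exists_le_densityLaw_ball (hh : IsHeavyTailedDensity h κ c₁) (hκ : 0 ≤ κ) (hc₁ : 0 < c₁)
    {s : ℕ → ℝ} {C D β R : ℝ} {p : ℕ} (hp : 1 ≤ p) (hC : 0 < C) (hD : 0 ≤ D) (hβ : 0 < β)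
    (hR : 0 ≤ R) (hs0 : ∀ l, 0 < s l) (hsC : ∀ l, s l ≤ C)
    (hsD : ∀ l : ℕ, Real.exp (-(D * (1 + (l : ℝ)) ^ p)) ≤ s l) :
    ∃ K : ℝ, 0 < K ∧ ∀ L : ℕ, 1 ≤ L → ∀ l ≤ L, ∀ a : ℝ, |a| ≤ R →
      ENNReal.ofReal (Real.exp (-(K * (L : ℝ) ^ ((p : ℝ) * (1 + κ))))) ≤
        densityLaw h {z | |s l * z - a| ≤ (2 : ℝ) ^ (-(L : ℝ) * (1 / 2 + β))} := by
  -- Chosen so that `log (1 + b) ≤ E L^p` for the point `b` below.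
  set E : ℝ := Real.log (R + 2) + D * 2 ^ p with hE
  have hlogR : 0 ≤ Real.log (R + 2) := Real.log_nonneg (by linarith)
  have hE0 : 0 ≤ E := by positivity
  -- The first two terms pay for the length `2δ / s_l` of the interval, the last for the density `h
  -- b` on it.
  refine ⟨|Real.log (2 / C)| + (1 / 2 + β) + c₁ * (1 + E ^ (1 + κ)), by positivity,
    fun L hL l hl a ha => ?_⟩
  have hL1 : (1 : ℝ) ≤ L := by exact_mod_cast hL
  have hL0 : (0 : ℝ) < L := by linarith
  have hp1 : (1 : ℝ) ≤ p := by exact_mod_cast hp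
  set q : ℝ := (p : ℝ) * (1 + κ) with hq
  have hq1 : 1 ≤ q := by nlinarith
  have hLq : (L : ℝ) ≤ (L : ℝ) ^ q := by
    simpa using Real.rpow_le_rpow_of_exponent_le hL1 hq1
  set δ : ℝ := (2 : ℝ) ^ (-(L : ℝ) * (1 / 2 + β)) with hδ
  have hδ0 : 0 < δ := by positivity
  have hδ1 : δ ≤ 1 := Real.rpow_le_one_of_one_le_of_nonpos one_le_two (by nlinarith)
  -- After division by `s_l` the target interval stays in `[-b, b]`: `|a| + δ ≤ R + 1` and `1 / s_l`
  -- is at most the exponential.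
  set b : ℝ := (R + 1) * Real.exp (D * (1 + (L : ℝ)) ^ p) with hb
  have hb0 : 0 ≤ b := by positivity
  have hsl := hs0 l
  have hsinv : (s l)⁻¹ ≤ Real.exp (D * (1 + (L : ℝ)) ^ p) := by
    calc (s l)⁻¹ ≤ (Real.exp (-(D * (1 + (l : ℝ)) ^ p)))⁻¹ :=
          inv_anti₀ (Real.exp_pos _) (hsD l)
      _ = Real.exp (D * (1 + (l : ℝ)) ^ p) := by rw [Real.exp_neg, inv_inv]
      _ ≤ _ := by
          have : (l : ℝ) ≤ L := by exact_mod_cast hl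
          gcongr
  have hset : {z : ℝ | |s l * z - a| ≤ δ} = {z | |z - a / s l| ≤ δ / s l} := by
    ext z
    simp only [Set.mem_ofPred_eq]
    rw [le_div_iff₀ hsl, ← abs_of_pos hsl, ← abs_mul, abs_of_pos hsl, sub_mul,
      div_mul_cancel₀ _ hsl.ne', mul_comm z]
  rw [hset]
  have hab : |a / s l| + δ / s l ≤ b := by
    rw [abs_div, abs_of_pos hsl, ← add_div, div_eq_mul_inv]
    exact mul_le_mul (by linarith) hsinv (by positivity) (by linarith)
  refine le_trans (ENNReal.ofReal_le_ofReal ?_)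
    (hh.le_densityLaw_ball (a / s l) (by positivity) hab)
  have hlogb : Real.log (1 + b) ≤ E * (L : ℝ) ^ p := by
    have hexp1 : 1 ≤ Real.exp (D * (1 + (L : ℝ)) ^ p) := Real.one_le_exp (by positivity)
    have hLp : (1 : ℝ) ≤ (L : ℝ) ^ p := one_le_pow₀ hL1
    calc Real.log (1 + b) ≤ Real.log ((R + 2) * Real.exp (D * (1 + (L : ℝ)) ^ p)) := by
          refine Real.log_le_log (by linarith) ?_
          rw [hb]
          linarith
      _ = Real.log (R + 2) + D * (1 + (L : ℝ)) ^ p := by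
          rw [Real.log_mul (by linarith) (Real.exp_pos _).ne', Real.log_exp]
      _ ≤ Real.log (R + 2) * (L : ℝ) ^ p + D * (2 * (L : ℝ)) ^ p := by
          refine add_le_add (le_mul_of_one_le_right hlogR hLp) ?_
          gcongr
          linarith
      _ = E * (L : ℝ) ^ p := by rw [hE, mul_pow]; ring
  have hpow : Real.log (1 + b) ^ (1 + κ) ≤ E ^ (1 + κ) * (L : ℝ) ^ q := by
    calc Real.log (1 + b) ^ (1 + κ) ≤ (E * (L : ℝ) ^ p) ^ (1 + κ) :=
          Real.rpow_le_rpow (Real.log_nonneg (by linarith)) hlogb (by linarith)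
      _ = _ := by
          rw [Real.mul_rpow hE0 (by positivity), ← Real.rpow_natCast, ← Real.rpow_mul hL0.le]
  have h1 : Real.exp (-(c₁ * (1 + E ^ (1 + κ)) * (L : ℝ) ^ q)) ≤ h b := by
    refine le_trans (Real.exp_le_exp.2 (neg_le_neg ?_)) (hh.exp_le hb0)
    rw [mul_assoc]
    refine mul_le_mul_of_nonneg_left ?_ hc₁.le
    linarith
  have h2 : Real.exp (-((|Real.log (2 / C)| + (1 / 2 + β)) * (L : ℝ) ^ q)) ≤ 2 * (δ / s l) := by
    calc _ ≤ Real.exp (Real.log (2 / C) + Real.log 2 * (-(L : ℝ) * (1 / 2 + β))) := by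
          refine Real.exp_le_exp.2 ?_
          have e1 : |Real.log (2 / C)| ≤ |Real.log (2 / C)| * (L : ℝ) ^ q :=
            le_mul_of_one_le_right (abs_nonneg _) (hL1.trans hLq)
          have e2 : Real.log 2 * ((L : ℝ) * (1 / 2 + β)) ≤ (1 / 2 + β) * (L : ℝ) ^ q := by
            have e3 : Real.log 2 ≤ 1 := by linarith [Real.log_two_lt_d9]
            have e4 : (L : ℝ) * (1 / 2 + β) ≤ (1 / 2 + β) * (L : ℝ) ^ q := by
              rw [mul_comm]
              exact mul_le_mul_of_nonneg_left hLq (by linarith)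
            have e5 : 0 ≤ (L : ℝ) * (1 / 2 + β) := by positivity
            nlinarith
          have e6 := neg_abs_le (Real.log (2 / C))
          linarith
      _ = 2 / C * δ := by
          rw [Real.exp_add, Real.exp_log (by positivity), hδ, Real.rpow_def_of_pos two_pos]
      _ ≤ 2 / s l * δ := by
          have := hsC l
          gcongr
      _ = _ := by ring
  calc _ = Real.exp (-((|Real.log (2 / C)| + (1 / 2 + β)) * (L : ℝ) ^ q)) *
        Real.exp (-(c₁ * (1 + E ^ (1 + κ)) * (L : ℝ) ^ q)) := by
        rw [← Real.exp_add]
        congr 1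
        ring
    _ ≤ _ := mul_le_mul h2 h1 (Real.exp_pos _).le (by positivity)

/-- Since `(1 + 4c₂)² ≥ 8c₂`, the complement has mass at most `u = 1/(4v²)`, and `1 - u ≥ exp
(-2u)`. -/
theorem le_densityLaw_of_tail (hh : IsHeavyTailedDensity h κ c₁) {c₂ : ℝ} (hc₂ : 0 < c₂)
    (htail : ∀ x : ℝ, 1 ≤ x → ∫ u in Set.Ioi x, h u ≤ c₂ / x ^ 2) {v : ℝ} (hv : 1 ≤ v) :
    ENNReal.ofReal (Real.exp (-(1 / 2 * (v ^ 2)⁻¹))) ≤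
      densityLaw h {z | |z| ≤ (1 + 4 * c₂) * v} := by
  have := hh.isProbabilityMeasure
  have ht1 : 1 ≤ (1 + 4 * c₂) * v := by nlinarith
  have hcompl : {z : ℝ | |z| ≤ (1 + 4 * c₂) * v} = {z | (1 + 4 * c₂) * v < |z|}ᶜ := by
    ext z
    simp
  have hmeas : MeasurableSet {z : ℝ | (1 + 4 * c₂) * v < |z|} :=
    measurableSet_lt measurable_const measurable_id.abs
  rw [hcompl, prob_compl_eq_one_sub hmeas]
  have hv2 : 0 < (v ^ 2)⁻¹ := by positivity
  have hv2' : (v ^ 2)⁻¹ ≤ 1 := inv_le_one_of_one_le₀ (one_le_pow₀ hv)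
  have hle : densityLaw h {z | (1 + 4 * c₂) * v < |z|} ≤ ENNReal.ofReal (1 / 4 * (v ^ 2)⁻¹) := by
    refine (hh.densityLaw_tail_le htail ht1).trans (ENNReal.ofReal_le_ofReal ?_)
    rw [mul_pow, ← div_div, div_eq_mul_inv _ (v ^ 2)]
    refine mul_le_mul_of_nonneg_right ?_ hv2.le
    rw [div_le_iff₀ (by positivity)]
    nlinarith
  calc _ ≤ ENNReal.ofReal (1 - 1 / 4 * (v ^ 2)⁻¹) := by
        refine ENNReal.ofReal_le_ofReal ?_
        refine le_trans (le_of_eq ?_) (exp_neg_two_mul_le (by positivity) (by linarith))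
        congr 1
        ring
    _ = 1 - ENNReal.ofReal (1 / 4 * (v ^ 2)⁻¹) := by
        rw [ENNReal.ofReal_sub _ (by positivity), ENNReal.ofReal_one]
    _ ≤ _ := tsub_le_tsub_left hle _

end IsHeavyTailedDensity

/-! ### The coefficient box: its mass and its sup-norm radius. -/

/-- Coefficient sequences that are within `2^{-L(1/2+β)}` of `f` up to level `L`, and at the levels
`l > L` are at most `R 2^{-l/2-Lβ-(l-L)η}`. -/
def coefBox {J : ℕ} (f : WIndex J → ℝ) (L : ℕ) (β η R : ℝ) : Set (WIndex J → ℝ) :=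
  {x | ∀ i, x i ∈ {y : ℝ |
    (WIndex.level i ≤ L → |y - f i| ≤ (2 : ℝ) ^ (-(L : ℝ) * (1 / 2 + β))) ∧
    (L < WIndex.level i → |y| ≤ R * (2 : ℝ) ^ (-((WIndex.level i : ℝ) / 2) - (L : ℝ) * β -
      ((WIndex.level i : ℝ) - L) * η))}}

theorem exists_le_coefLaw_coefBox {J : ℕ} {h : ℝ → ℝ} {κ c₁ c₂ : ℝ} (hκ : 0 ≤ κ) (hc₁ : 0 < c₁)
    (hc₂ : 0 < c₂) (hh : IsHeavyTailedDensity h κ c₁)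
    (htail : ∀ x : ℝ, 1 ≤ x → ∫ u in Set.Ioi x, h u ≤ c₂ / x ^ 2)
    {s : ℕ → ℝ} {C D α β R : ℝ} {p : ℕ} (hp : 1 ≤ p) (hC : 0 < C) (hD : 0 ≤ D)
    (hα : 1 / 2 < α) (hβ : 0 < β) (hβα : β ≤ α) (hR : 0 ≤ R) (hs0 : ∀ l, 0 < s l)
    (hs : ∀ l, s l ≤ C * scaleHT α l)
    (hsD : ∀ l : ℕ, Real.exp (-(D * (1 + (l : ℝ)) ^ p)) ≤ s l) :
    ∃ K : ℝ, 0 < K ∧ ∀ L : ℕ, 1 ≤ L → ∀ f : WIndex J → ℝ, (∀ i, |f i| ≤ R) →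
      ENNReal.ofReal (Real.exp (-(K * 2 ^ L * (L : ℝ) ^ ((p : ℝ) * (1 + κ))))) ≤
        coefLaw J s h (coefBox f L β ((α - 1 / 2) / 2) (C * (1 + 4 * c₂))) := by
  have hsC : ∀ l, s l ≤ C := fun l => (hs l).trans <| mul_le_of_le_one_right hC.le <|
    Real.rpow_le_one_of_one_le_of_nonpos one_le_two (by
      have : (0 : ℝ) ≤ l := Nat.cast_nonneg l
      nlinarith)
  obtain ⟨K, hK0, hK⟩ := hh.exists_le_densityLaw_ball hκ hc₁ hp hC hD hβ hR hs0 hsC hsD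
  set q : ℝ := (p : ℝ) * (1 + κ) with hq
  -- The ratio of the total costs of successive levels above `L`: twice as many coefficients, each
  -- cheaper by `2^{-(α+1/2)}`.
  set r : ℝ := (2 : ℝ) ^ (1 / 2 - α) with hr
  have hr1 : r < 1 := Real.rpow_lt_one_of_one_lt_of_neg one_lt_two (by linarith)
  have hr0 : 0 < r := by positivity
  have h1r : 0 < 1 - r := by linarith
  refine ⟨2 * (2 * K + 1 / (1 - r)), by positivity, fun L hL f hf => ?_⟩
  have hL1 : (1 : ℝ) ≤ L := by exact_mod_cast hL
  have hLq : 1 ≤ (L : ℝ) ^ q := Real.one_le_rpow hL1 (by positivity)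
  -- The cost, that is the negative log probability allowed, of one coefficient at level `l`.
  let e : ℕ → ℝ := fun l => if l ≤ L then K * (L : ℝ) ^ q
    else 1 / 2 * (2 : ℝ) ^ (-((l : ℝ) - L) * (α + 1 / 2))
  have he0 : ∀ l, 0 ≤ e l := fun l => by
    simp only [e]
    split_ifs <;> positivity
  have hsum := summable_and_tsum_le_of_geometric (a := fun l => (2 : ℝ) ^ l * e l) (L := L)
    (x := 2) (r := r) (A := K * (L : ℝ) ^ q) (B := 2 ^ L) one_lt_two hr0.le hr1 (by positivity)
    (fun l => mul_nonneg (by positivity) (he0 l))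
    (fun l hl => by
      simp only [e, hl, if_true]
      rw [mul_comm])
    (fun m => by
      have hm : ¬ (m + (L + 1) ≤ L) := by omega
      simp only [e, hm, if_false]
      have hx : (2 : ℝ) ^ (-((((m + (L + 1) : ℕ)) : ℝ) - L) * (α + 1 / 2)) ≤
          (2 : ℝ) ^ (-(m : ℝ)) * r ^ m / 2 := by
        have h2 : (2 : ℝ) ^ (-(m : ℝ)) * r ^ m / 2 =
            (2 : ℝ) ^ (-(m : ℝ) + m * (1 / 2 - α) - 1) := by
          rw [Real.rpow_sub two_pos, Real.rpow_add two_pos, two_rpow_level_mul, Real.rpow_one]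
        rw [h2]
        refine Real.rpow_le_rpow_of_exponent_le one_le_two ?_
        push_cast
        nlinarith
      calc (2 : ℝ) ^ (m + (L + 1)) *
            (1 / 2 * (2 : ℝ) ^ (-((((m + (L + 1) : ℕ)) : ℝ) - L) * (α + 1 / 2)))
          ≤ (2 : ℝ) ^ (m + (L + 1)) * (1 / 2 * ((2 : ℝ) ^ (-(m : ℝ)) * r ^ m / 2)) := by gcongr
        _ = (2 ^ m * ((2 : ℝ) ^ m)⁻¹) * 2 ^ L * r ^ m / 2 := by
            rw [Real.rpow_neg zero_le_two, Real.rpow_natCast]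
            ring
        _ ≤ 2 ^ L * r ^ m := by
            rw [mul_inv_cancel₀ (by positivity), one_mul]
            have : 0 ≤ 2 ^ L * r ^ m := by positivity
            linarith)
  have : ∀ i : WIndex J, IsProbabilityMeasure
      ((densityLaw h).map fun z => s (WIndex.level i) * z) :=
    fun i => isProbabilityMeasure_map_mul hh _
  have hE : ∀ F : Finset (WIndex J), ∑ i ∈ F, e (WIndex.level i) ≤
      2 * (2 * K + 1 / (1 - r)) * 2 ^ L * (L : ℝ) ^ q := by
    intro F
    refine (sum_comp_level_le he0 hsum.1 F).trans ?_
    have h3 : (2 : ℝ) ^ L / (1 - r) ≤ 2 ^ L / (1 - r) * (L : ℝ) ^ q :=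
      le_mul_of_one_le_right (by positivity) hLq
    have h4 := hsum.2
    calc 2 * ∑' l : ℕ, (2 : ℝ) ^ l * e l
        ≤ 2 * (K * (L : ℝ) ^ q * (2 ^ (L + 1) / (2 - 1)) + 2 ^ L / (1 - r) * (L : ℝ) ^ q) := by
          linarith
      _ = _ := by ring
  refine le_infinitePi_box (fun i : WIndex J => (densityLaw h).map fun z => s (WIndex.level i) * z)
    (fun i => ?_) hE fun i => ?_
  · refine MeasurableSet.inter ?_ ?_
    · refine MeasurableSet.imp (MeasurableSet.const _) ?_
      exact measurableSet_le (measurable_id.sub_const _).abs measurable_const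
    · refine MeasurableSet.imp (MeasurableSet.const _) ?_
      exact measurableSet_le measurable_id.abs measurable_const
  · refine le_trans ?_ (Measure.le_map_apply (by fun_prop) _)
    by_cases hi : WIndex.level i ≤ L
    · simp only [e, hi, if_true]
      refine (hK L hL _ hi (f i) (hf i)).trans (measure_mono fun z hz => ?_)
      exact ⟨fun _ => hz, fun h => absurd hi (not_le.2 h)⟩
    · simp only [e, hi, if_false]
      set l := WIndex.level i with hl
      have hlL : (L : ℝ) ≤ l := by exact_mod_cast (not_le.1 hi).le
      -- The size allowed to `ζ`: `v^{-2}` gives the cost `e l`, while `scaleHT α l * v` still fits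
      -- in the box.
      set v : ℝ := (2 : ℝ) ^ (((l : ℝ) - L) * ((α + 1 / 2) / 2)) with hv
      have hv1 : 1 ≤ v := Real.one_le_rpow one_le_two (by
        have : 0 ≤ (l : ℝ) - L := by linarith
        positivity)
      have hv2 : (v ^ 2)⁻¹ = (2 : ℝ) ^ (-((l : ℝ) - L) * (α + 1 / 2)) := by
        rw [hv, ← Real.rpow_natCast, ← Real.rpow_mul zero_le_two, ← Real.rpow_neg zero_le_two]
        congr 1
        push_cast
        ring
      rw [← hv2]
      refine (hh.le_densityLaw_of_tail hc₂ htail hv1).trans (measure_mono fun z hz => ?_)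
      refine ⟨False.elim, fun _ => ?_⟩
      have hz' : |z| ≤ (1 + 4 * c₂) * v := hz
      rw [abs_mul, abs_of_pos (hs0 l)]
      calc s l * |z| ≤ C * scaleHT α l * ((1 + 4 * c₂) * v) :=
            mul_le_mul (hs l) hz' (abs_nonneg _) ((hs0 l).le.trans (hs l))
        _ = C * (1 + 4 * c₂) * (scaleHT α l * v) := by ring
        _ ≤ _ := by
            refine mul_le_mul_of_nonneg_left ?_ (by positivity)
            rw [scaleHT, hv, ← Real.rpow_add two_pos]
            refine Real.rpow_le_rpow_of_exponent_le one_le_two ?_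
            -- The exponents differ by exactly `L (α - β)`; this is where `β ≤ α` enters.
            nlinarith [mul_nonneg (Nat.cast_nonneg (α := ℝ) L) (sub_nonneg.2 hβα)]

theorem exists_supNorm_le_of_mem_coefBox (W : BoundaryCorrectedWaveletBasis) {β η L₀ R : ℝ}
    (hβ : 0 < β) (hη : 0 < η) (hL₀ : 0 < L₀) (hR : 0 ≤ R) :
    ∃ K : ℝ, 0 < K ∧ ∀ L : ℕ, ∀ f₀ ∈ holderBall W β L₀,
      ∀ x ∈ coefBox (fun i => inner ℝ f₀ (W.basis i)) L β η R,
        (Summable fun i => x i • W.basis i) →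
        supNorm (waveletSeries W x - f₀) ≤ ENNReal.ofReal (K * (2 : ℝ) ^ (-(L : ℝ) * β)) := by
  obtain ⟨C, hC0, hC⟩ := W.exists_supNorm_le
  set y : ℝ := (2 : ℝ) ^ (1 / 2 : ℝ) with hy
  have hy1 : 1 < y := Real.one_lt_rpow one_lt_two (by norm_num)
  -- Above `L` the contributions of the series and of `f₀` decay at rates `η` and `β`; the slower
  -- one governs.
  set r : ℝ := (2 : ℝ) ^ (-min η β) with hr
  have hmin : 0 < min η β := lt_min hη hβ
  have hr1 : r < 1 := Real.rpow_lt_one_of_one_lt_of_neg one_lt_two (by linarith)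
  have hr0 : 0 < r := by positivity
  have h1r : 0 < 1 - r := by linarith
  have hy1' : 0 < y - 1 := by linarith
  -- The `+ 1` keeps the constant positive even if `C = 0`.
  refine ⟨C * (y / (y - 1) + (R + L₀) / (1 - r)) + 1, by positivity, fun L f₀ hf₀ x hx hxs => ?_⟩
  set δ : ℝ := (2 : ℝ) ^ (-(L : ℝ) * (1 / 2 + β)) with hδ
  let A : ℕ → ℝ := fun l => if l ≤ L then δ else
    R * (2 : ℝ) ^ (-((l : ℝ) / 2) - (L : ℝ) * β - ((l : ℝ) - L) * η) +
      (2 : ℝ) ^ (-(l : ℝ) * (1 / 2 + β)) * L₀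
  have hA0 : ∀ l, 0 ≤ A l := fun l => by
    simp only [A]
    split_ifs <;> positivity
  have hfA : ∀ i, |inner ℝ (waveletSeries W x - f₀) (W.basis i)| ≤ A (WIndex.level i) := by
    intro i
    rw [inner_sub_left, waveletSeries, W.basis.inner_tsum_smul hxs]
    by_cases hi : WIndex.level i ≤ L
    · simp only [A, hi, if_true]
      exact (hx i).1 hi
    · simp only [A, hi, if_false]
      exact (abs_sub _ _).trans (add_le_add ((hx i).2 (not_le.1 hi)) (hf₀ i))
  have hsum := summable_and_tsum_le_of_geometric (a := fun l : ℕ => (2 : ℝ) ^ ((l : ℝ) / 2) * A l)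
    (L := L) (x := y) (r := r) (A := δ) (B := (R + L₀) * (2 : ℝ) ^ (-(L : ℝ) * β)) hy1 hr0.le hr1
    (by positivity) (fun l => mul_nonneg (by positivity) (hA0 l))
    (fun l hl => by
      simp only [A, hl, if_true]
      rw [hy, ← two_rpow_level_mul, mul_comm, mul_one_div])
    (fun m => by
      have hm : ¬ (m + (L + 1) ≤ L) := by omega
      simp only [A, hm, if_false]
      have hrm : (2 : ℝ) ^ (-(L : ℝ) * β) * r ^ m =
          (2 : ℝ) ^ (-(L : ℝ) * β - m * min η β) := by
        rw [hr, ← two_rpow_level_mul, ← Real.rpow_add two_pos]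
        congr 1
        ring
      have hm0 : (0 : ℝ) ≤ m := Nat.cast_nonneg m
      have e1 : (2 : ℝ) ^ (((m + (L + 1) : ℕ) : ℝ) / 2) *
          (2 : ℝ) ^ (-(((m + (L + 1) : ℕ) : ℝ) / 2) - (L : ℝ) * β -
            (((m + (L + 1) : ℕ) : ℝ) - L) * η) ≤ (2 : ℝ) ^ (-(L : ℝ) * β) * r ^ m := by
        rw [hrm, ← Real.rpow_add two_pos]
        refine Real.rpow_le_rpow_of_exponent_le one_le_two ?_
        push_cast
        nlinarith [min_le_left η β]
      have e2 : (2 : ℝ) ^ (((m + (L + 1) : ℕ) : ℝ) / 2) *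
          (2 : ℝ) ^ (-(((m + (L + 1) : ℕ)) : ℝ) * (1 / 2 + β)) ≤
            (2 : ℝ) ^ (-(L : ℝ) * β) * r ^ m := by
        rw [hrm, ← Real.rpow_add two_pos]
        refine Real.rpow_le_rpow_of_exponent_le one_le_two ?_
        push_cast
        nlinarith [min_le_right η β]
      rw [mul_add, mul_left_comm, ← mul_assoc _ _ L₀, mul_comm _ L₀]
      have := add_le_add (mul_le_mul_of_nonneg_left e1 hR) (mul_le_mul_of_nonneg_left e2 hL₀.le)
      refine this.trans_eq ?_
      ring)
  refine (hC _ A hA0 hfA hsum.1).trans (ENNReal.ofReal_le_ofReal ?_)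
  have hδy : δ * (y ^ (L + 1) / (y - 1)) = (2 : ℝ) ^ (-(L : ℝ) * β) * (y / (y - 1)) := by
    have : δ * y ^ L = (2 : ℝ) ^ (-(L : ℝ) * β) := by
      rw [hy, ← two_rpow_level_mul, hδ, ← Real.rpow_add two_pos]
      congr 1
      ring
    rw [← this]
    ring
  have h5 := mul_le_mul_of_nonneg_left hsum.2 hC0
  rw [hδy] at h5
  refine h5.trans ?_
  have h6 : 0 < (2 : ℝ) ^ (-(L : ℝ) * β) := by positivity
  calc _ = C * (y / (y - 1) + (R + L₀) / (1 - r)) * (2 : ℝ) ^ (-(L : ℝ) * β) := by ring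
    _ ≤ _ := by
        rw [add_mul, one_mul]
        linarith

/-- Small ball probability in terms of the cutoff level. -/
theorem exists_le_waveletPrior_level (W : BoundaryCorrectedWaveletBasis) {h : ℝ → ℝ}
    {κ c₁ c₂ : ℝ} (hκ : 0 ≤ κ) (hc₁ : 0 < c₁)
    (hc₂ : 0 < c₂) (hh : IsHeavyTailedDensity h κ c₁)
    (htail : ∀ x : ℝ, 1 ≤ x → ∫ u in Set.Ioi x, h u ≤ c₂ / x ^ 2)
    {s : ℕ → ℝ} {C D α β L₀ : ℝ} {p : ℕ} (hp : 1 ≤ p) (hC : 0 < C) (hD : 0 ≤ D)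
    (hα : 1 / 2 < α) (hβ : 0 < β) (hβα : β ≤ α) (hL₀ : 0 < L₀) (hs0 : ∀ l, 0 < s l)
    (hs : ∀ l, s l ≤ C * scaleHT α l)
    (hsD : ∀ l : ℕ, Real.exp (-(D * (1 + (l : ℝ)) ^ p)) ≤ s l) :
    ∃ K₁ K₂ : ℝ, 0 < K₁ ∧ 0 < K₂ ∧ ∀ L : ℕ, 1 ≤ L → ∀ f₀ ∈ holderBall W β L₀,
      ENNReal.ofReal (Real.exp (-(K₁ * 2 ^ L * (L : ℝ) ^ ((p : ℝ) * (1 + κ))))) ≤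
        waveletPrior W s h
          {f | supNorm (f - f₀) ≤ ENNReal.ofReal (K₂ * (2 : ℝ) ^ (-(L : ℝ) * β))} := by
  obtain ⟨K₁, hK₁, h₁⟩ := exists_le_coefLaw_coefBox (J := W.J) hκ hc₁ hc₂ hh htail hp hC hD hα hβ
    hβα hL₀.le hs0 hs hsD
  obtain ⟨K₂, hK₂, h₂⟩ := exists_supNorm_le_of_mem_coefBox W (η := (α - 1 / 2) / 2)
    (R := C * (1 + 4 * c₂)) hβ (by linarith) hL₀ (by positivity)
  refine ⟨K₁, K₂, hK₁, hK₂, fun L hL f₀ hf₀ => ?_⟩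
  have hbd : ∀ i, |inner ℝ f₀ (W.basis i)| ≤ L₀ := fun i => (hf₀ i).trans <|
    mul_le_of_le_one_left hL₀.le <| Real.rpow_le_one_of_one_le_of_nonpos one_le_two (by
      have : (0 : ℝ) ≤ (WIndex.level i : ℝ) := Nat.cast_nonneg _
      nlinarith)
  exact (h₁ L hL _ hbd).trans <| le_waveletPrior W (ae_summable_series W hh htail hα hs0 hs)
    fun x hx hxs => h₂ L f₀ hf₀ x hx hxs

/-! ### Choice of the cutoff level and the resulting rate. -/

/-- `L` is taken with `2^L ≤ cT < 2^{L+1}`: the upper bound on `2^L` controls the cost, the lower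
bound `cT/2` the radius. -/
theorem exists_level_near {K₁ d β q : ℝ} (hK₁ : 0 < K₁) (hd : 0 < d) (hβ : 0 < β) (hq : 0 ≤ q) :
    ∃ c : ℝ, 0 < c ∧ ∀ T : ℝ, 2 / c ≤ T → ∃ L : ℕ, 1 ≤ L ∧
      K₁ * 2 ^ L * (L : ℝ) ^ q ≤ d * T * Real.log T ^ q ∧
      (2 : ℝ) ^ (-(L : ℝ) * β) ≤ (c / 2) ^ (-β) * T ^ (-β) := by
  have hlog2 : 0 < Real.log 2 := Real.log_pos one_lt_two
  -- `c ≤ 1` gives `L ≤ log T / log 2`; the other bound absorbs `K₁` and the power of `log 2` into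
  -- `d`.
  refine ⟨min 1 (d * Real.log 2 ^ q / K₁), lt_min one_pos (by positivity), ?_⟩
  set c : ℝ := min 1 (d * Real.log 2 ^ q / K₁) with hc
  have hc0 : 0 < c := lt_min one_pos (by positivity)
  intro T hT
  have hT0 : 0 < T := lt_of_lt_of_le (by positivity) hT
  have hcT : 2 ≤ c * T := by
    rw [div_le_iff₀ hc0] at hT
    linarith
  obtain ⟨L, hL1, hL2⟩ := exists_nat_pow_near (by linarith : 1 ≤ c * T) one_lt_two
  have hL : 1 ≤ L := by
    by_contra h0
    have : L = 0 := by omega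
    subst this
    norm_num at hL2
    linarith
  refine ⟨L, hL, ?_, ?_⟩
  · have hle : (2 : ℝ) ^ L ≤ T := hL1.trans (by
      have := min_le_left (1 : ℝ) (d * Real.log 2 ^ q / K₁)
      nlinarith)
    have hlog : (L : ℝ) ≤ Real.log T / Real.log 2 := by
      rw [le_div_iff₀ hlog2, ← Real.log_pow]
      exact Real.log_le_log (by positivity) hle
    have hlogT : 0 ≤ Real.log T := by
      have : (0 : ℝ) ≤ L := Nat.cast_nonneg L
      have h3 := this.trans hlog
      rw [le_div_iff₀ hlog2, zero_mul] at h3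
      exact h3
    have hcK : K₁ * c ≤ d * Real.log 2 ^ q := by
      have := min_le_right (1 : ℝ) (d * Real.log 2 ^ q / K₁)
      rw [← hc, le_div_iff₀ hK₁] at this
      linarith
    calc K₁ * 2 ^ L * (L : ℝ) ^ q ≤ K₁ * (c * T) * (Real.log T / Real.log 2) ^ q := by gcongr
      _ = K₁ * c * (T * (Real.log T ^ q / Real.log 2 ^ q)) := by
          rw [Real.div_rpow hlogT hlog2.le]
          ring
      _ ≤ d * Real.log 2 ^ q * (T * (Real.log T ^ q / Real.log 2 ^ q)) :=
          mul_le_mul_of_nonneg_right hcK (by positivity)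
      _ = d * T * Real.log T ^ q := by
          have : Real.log 2 ^ q ≠ 0 := by positivity
          field_simp
  · rw [← Real.mul_rpow (by positivity) hT0.le, Real.rpow_mul zero_le_two,
      Real.rpow_neg zero_le_two, Real.rpow_natCast, Real.inv_rpow (by positivity),
      ← Real.rpow_neg (by positivity)]
    refine Real.rpow_le_rpow_of_nonpos (by positivity) ?_ (by linarith)
    rw [pow_succ] at hL2
    linarith

/-- The rate `(log n)^{qβ/(1+2β)} n^{-β/(2β+1)}`. -/
noncomputable def rateLog (q β : ℝ) (n : ℕ) : ℝ :=
  Real.log n ^ (q * β / (1 + 2 * β)) * (n : ℝ) ^ (-(β / (2 * β + 1)))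

/-- The effective dimension `(n / (log n)^q)^{1/(1+2β)}` that belongs to the rate `rateLog`. -/
noncomputable def effDim (q β : ℝ) (n : ℕ) : ℝ :=
  ((n : ℝ) / Real.log n ^ q) ^ (1 / (1 + 2 * β))

theorem one_le_log_natCast {n : ℕ} (hn : 3 ≤ n) : 1 ≤ Real.log n := by
  rw [Real.le_log_iff_exp_le (by positivity)]
  have : (3 : ℝ) ≤ n := by exact_mod_cast hn
  linarith [Real.exp_one_lt_d9]

theorem effDim_pos {q β : ℝ} {n : ℕ} (hn : 3 ≤ n) : 0 < effDim q β n := by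
  have h1 : 0 < Real.log n := one_pos.trans_le (one_le_log_natCast hn)
  have h2 : (0 : ℝ) < n := by positivity
  unfold effDim
  positivity

theorem effDim_rpow_neg {q β : ℝ} {n : ℕ} (hn : 3 ≤ n) :
    effDim q β n ^ (-β) = rateLog q β n := by
  have h1 : 0 < Real.log n := one_pos.trans_le (one_le_log_natCast hn)
  have h2 : (0 : ℝ) < n := by positivity
  unfold effDim rateLog
  rw [← Real.rpow_mul (by positivity), Real.div_rpow h2.le (by positivity), ← Real.rpow_mul h1.le,
    div_eq_mul_inv, ← Real.rpow_neg h1.le, mul_comm]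
  congr 2
  · ring
  · rw [add_comm 1]
    ring

/-- The balance defining the effective dimension `T`: `T^{1+2β} = n / (log n)^q` means `n T^{-2β} =
T (log n)^q`. -/
theorem mul_rateLog_sq {q β : ℝ} (hβ : 0 < β) {n : ℕ} (hn : 3 ≤ n) :
    n * rateLog q β n ^ 2 = effDim q β n * Real.log n ^ q := by
  have h1 : 0 < Real.log n := one_pos.trans_le (one_le_log_natCast hn)
  have h2 : (0 : ℝ) < n := by positivity
  have hT := effDim_pos (q := q) (β := β) hn
  have h3 : effDim q β n ^ (1 + 2 * β) = n / Real.log n ^ q := by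
    unfold effDim
    rw [← Real.rpow_mul (by positivity), one_div_mul_cancel (by positivity), Real.rpow_one]
  have h4 : (n : ℝ) = effDim q β n ^ (1 + 2 * β) * Real.log n ^ q := by
    rw [h3, div_mul_cancel₀]
    positivity
  calc n * rateLog q β n ^ 2
      = effDim q β n ^ (1 + 2 * β) * Real.log n ^ q * (effDim q β n ^ (-β)) ^ 2 := by
        rw [← h4, effDim_rpow_neg hn]
    _ = effDim q β n ^ (1 + 2 * β) * effDim q β n ^ (-β * 2) * Real.log n ^ q := by
        rw [Real.rpow_mul hT.le, ← Real.rpow_two]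
        ring
    _ = _ := by
        rw [← Real.rpow_add hT, show 1 + 2 * β + -β * 2 = 1 by ring, Real.rpow_one]

theorem log_effDim_le {q β : ℝ} (hq : 0 ≤ q) (hβ : 0 < β) {n : ℕ} (hn : 3 ≤ n) :
    Real.log (effDim q β n) ≤ Real.log n := by
  have h1 := one_le_log_natCast hn
  have h2 : (1 : ℝ) ≤ n := by exact_mod_cast (by omega : 1 ≤ n)
  have h3 : 1 ≤ Real.log n ^ q := Real.one_le_rpow h1 hq
  refine Real.log_le_log (effDim_pos hn) ?_
  calc effDim q β n ≤ (n : ℝ) ^ (1 / (1 + 2 * β)) := by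
        unfold effDim
        exact Real.rpow_le_rpow (by positivity) (div_le_self (by positivity) h3) (by positivity)
    _ ≤ (n : ℝ) ^ (1 : ℝ) := by
        refine Real.rpow_le_rpow_of_exponent_le h2 ?_
        rw [div_le_one (by positivity)]
        linarith
    _ = n := Real.rpow_one _

theorem tendsto_effDim_atTop {β : ℝ} (q : ℝ) (hβ : 0 < β) :
    Tendsto (effDim q β) atTop atTop := by
  have h1 : Tendsto (fun x : ℝ => x / Real.log x ^ q) atTop atTop := by
    have h2 := (isLittleO_log_rpow_rpow_atTop q one_pos).tendsto_div_nhds_zero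
    have h3 : Tendsto (fun x : ℝ => Real.log x ^ q / x ^ (1 : ℝ)) atTop (nhdsWithin 0 (Set.Ioi 0)) := by
      refine tendsto_nhdsWithin_iff.2 ⟨h2, ?_⟩
      filter_upwards [eventually_gt_atTop 1] with x hx
      have : 0 < Real.log x := Real.log_pos hx
      have : 0 < x := by linarith
      simp only [Set.mem_Ioi]
      positivity
    refine h3.inv_tendsto_nhdsGT_zero.congr fun x => ?_
    simp
  exact (tendsto_rpow_atTop (by positivity)).comp (h1.comp tendsto_natCast_atTop_atTop)

/-- Small ball probability at every rate that dominates `rateLog`. -/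
theorem eventually_le_waveletPrior (W : BoundaryCorrectedWaveletBasis) {h : ℝ → ℝ}
    {κ c₁ c₂ : ℝ} (hκ : 0 ≤ κ) (hc₁ : 0 < c₁)
    (hc₂ : 0 < c₂) (hh : IsHeavyTailedDensity h κ c₁)
    (htail : ∀ x : ℝ, 1 ≤ x → ∫ u in Set.Ioi x, h u ≤ c₂ / x ^ 2)
    {s : ℕ → ℝ} {C D α β L₀ : ℝ} {p : ℕ} (hp : 1 ≤ p) (hC : 0 < C) (hD : 0 ≤ D)
    (hα : 1 / 2 < α) (hβ : 0 < β) (hβα : β ≤ α) (hL₀ : 0 < L₀) (hs0 : ∀ l, 0 < s l)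
    (hs : ∀ l, s l ≤ C * scaleHT α l)
    (hsD : ∀ l : ℕ, Real.exp (-(D * (1 + (l : ℝ)) ^ p)) ≤ s l) {ρ : ℕ → ℝ}
    (hρ : ∀ᶠ n in atTop, rateLog ((p : ℝ) * (1 + κ)) β n ≤ ρ n)
    {f₀ : L2I} (hf₀ : f₀ ∈ holderBall W β L₀) {d₂ : ℝ} (hd₂ : 0 < d₂) :
    ∃ d₁ : ℝ, 0 < d₁ ∧ ∀ᶠ n : ℕ in atTop,
      ENNReal.ofReal (Real.exp (-(d₂ * n * ρ n ^ 2))) ≤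
        waveletPrior W s h {f | supNorm (f - f₀) < ENNReal.ofReal (d₁ * ρ n)} := by
  obtain ⟨K₁, K₂, hK₁, hK₂, hK⟩ := exists_le_waveletPrior_level W hκ hc₁ hc₂ hh htail hp hC hD hα
    hβ hβα hL₀ hs0 hs hsD
  set q : ℝ := (p : ℝ) * (1 + κ) with hq
  have hq0 : 0 ≤ q := by positivity
  obtain ⟨c, hc, hcL⟩ := exists_level_near hK₁ hd₂ hβ hq0
  -- The factor 2 turns the closed ball into the open one.
  refine ⟨2 * (K₂ * (c / 2) ^ (-β)), by positivity, ?_⟩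
  filter_upwards [hρ, eventually_ge_atTop 3,
    (tendsto_effDim_atTop q hβ).eventually_ge_atTop (2 / c),
    (tendsto_effDim_atTop q hβ).eventually_ge_atTop 1] with n hρn hn hTn hT1
  obtain ⟨L, hL, hLp, hLr⟩ := hcL _ hTn
  have hT := effDim_pos (q := q) (β := β) hn
  have hr0 : 0 < rateLog q β n := by
    rw [← effDim_rpow_neg hn]
    positivity
  have hρ0 : 0 < ρ n := hr0.trans_le hρn
  refine le_trans (ENNReal.ofReal_le_ofReal (Real.exp_le_exp.2 (neg_le_neg ?_)))
    ((hK L hL f₀ hf₀).trans (measure_mono ?_))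
  · have hn1 := one_le_log_natCast hn
    have hsq : rateLog q β n ^ 2 ≤ ρ n ^ 2 := pow_le_pow_left₀ hr0.le hρn 2
    have hlog : d₂ * effDim q β n * Real.log (effDim q β n) ^ q ≤
        d₂ * effDim q β n * Real.log n ^ q := by
      refine mul_le_mul_of_nonneg_left ?_ (by positivity)
      exact Real.rpow_le_rpow (Real.log_nonneg hT1) (log_effDim_le hq0 hβ hn) hq0
    calc _ ≤ d₂ * effDim q β n * Real.log n ^ q := hLp.trans hlog
      _ = d₂ * (n * rateLog q β n ^ 2) := by rw [mul_rateLog_sq hβ hn, mul_assoc]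
      _ ≤ d₂ * (n * ρ n ^ 2) := by gcongr
      _ = _ := by ring
  · intro f hf
    refine lt_of_le_of_lt hf (ENNReal.ofReal_lt_ofReal_iff (by positivity) |>.2 ?_)
    rw [effDim_rpow_neg hn] at hLr
    calc K₂ * (2 : ℝ) ^ (-(L : ℝ) * β) ≤ K₂ * ((c / 2) ^ (-β) * rateLog q β n) := by gcongr
      _ = K₂ * (c / 2) ^ (-β) * rateLog q β n := by ring
      _ < 2 * (K₂ * (c / 2) ^ (-β)) * rateLog q β n := by
          refine mul_lt_mul_of_pos_right ?_ hr0
          have : 0 < K₂ * (c / 2) ^ (-β) := by positivity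
          linarith
      _ ≤ _ := by gcongr

/-! ### The two scalings and their rates. -/

theorem scaleHT_pos (α : ℝ) (l : ℕ) : 0 < scaleHT α l := by
  unfold scaleHT
  positivity

theorem scaleOT_pos (l : ℕ) : 0 < scaleOT l := by
  unfold scaleOT
  positivity

theorem exp_neg_le_two_rpow_neg {x y : ℝ} (hx : 0 ≤ x) (hxy : x ≤ y) :
    Real.exp (-y) ≤ (2 : ℝ) ^ (-x) := by
  rw [Real.rpow_def_of_pos two_pos, Real.exp_le_exp]
  nlinarith [Real.log_two_lt_d9]

theorem exp_neg_le_scaleHT {α : ℝ} (hα : 0 < α) (l : ℕ) :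
    Real.exp (-((1 / 2 + α) * (1 + (l : ℝ)) ^ 1)) ≤ scaleHT α l := by
  unfold scaleHT
  rw [neg_mul]
  have : (0 : ℝ) ≤ l := Nat.cast_nonneg l
  exact exp_neg_le_two_rpow_neg (by positivity) (by nlinarith)

theorem exp_neg_le_scaleOT (l : ℕ) : Real.exp (-(1 * (1 + (l : ℝ)) ^ 2)) ≤ scaleOT l := by
  unfold scaleOT
  have : (0 : ℝ) ≤ l := Nat.cast_nonneg l
  exact exp_neg_le_two_rpow_neg (by positivity) (by nlinarith)

/-- With `a = 1/2 + α`, `l² - a l + a² ≥ 0`. Hence this scaling is admissible for every `α`, and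
adapts to every `β`. -/
theorem scaleOT_le (α : ℝ) (l : ℕ) :
    scaleOT l ≤ (2 : ℝ) ^ ((1 / 2 + α) ^ 2) * scaleHT α l := by
  unfold scaleOT scaleHT
  rw [← Real.rpow_add two_pos]
  refine Real.rpow_le_rpow_of_exponent_le one_le_two ?_
  nlinarith [sq_nonneg ((l : ℝ) - (1 / 2 + α)), sq_nonneg (l : ℝ), sq_nonneg (1 / 2 + α)]

/-- The target rate exceeds the one obtained here by a factor `(log n)^{1/(1+2β)}` and a power of
`log log n`, both eventually at least 1. -/
theorem eventually_rateLog_le_rateHT {κ β : ℝ} (hβ : 0 < β) :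
    ∀ᶠ n in atTop, rateLog (((1 : ℕ) : ℝ) * (1 + κ)) β n ≤ rateHT κ β n := by
  have hll : Tendsto (fun n : ℕ => Real.log (Real.log n)) atTop atTop :=
    Real.tendsto_log_atTop.comp (Real.tendsto_log_atTop.comp tendsto_natCast_atTop_atTop)
  filter_upwards [hll.eventually_ge_atTop 1, eventually_ge_atTop 3] with n hn hn3
  have h1 := one_le_log_natCast hn3
  unfold rateLog rateHT
  refine mul_le_mul_of_nonneg_right ?_ (by positivity)
  rw [← one_mul (Real.log n ^ _)]
  refine mul_le_mul (Real.one_le_rpow hn (by positivity)) ?_ (by positivity) (by positivity)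
  refine Real.rpow_le_rpow_of_exponent_le h1 ?_
  gcongr
  push_cast
  linarith

theorem rateLog_eq_rateOT (κ β : ℝ) (n : ℕ) :
    rateLog (((2 : ℕ) : ℝ) * (1 + κ)) β n = rateOT κ β n := by
  unfold rateLog rateOT
  congr 3
  push_cast
  ring

/-- Prior mass lower bounds in `L^∞` for heavy-tailed wavelet series priors. In each of the two
parts, the first conjunct says that the random series which defines the prior converges almost
surely. -/
theorem theorem7 (W : BoundaryCorrectedWaveletBasis) (h : ℝ → ℝ) (κ c₁ c₂ : ℝ)
    (hκ : 0 ≤ κ) (hc₁ : 0 < c₁) (hc₂ : 0 < c₂)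
    (hh : IsHeavyTailedDensity h κ c₁)
    (htail : ∀ x : ℝ, 1 ≤ x → ∫ u in Set.Ioi x, h u ≤ c₂ / x ^ 2) :
    (∀ α : ℝ, 1 / 2 < α →
      (∀ᵐ x ∂(coefLaw W.J (scaleHT α) h), Summable fun i => x i • W.basis i) ∧
      ∀ β : ℝ, 0 < β → β ≤ α → ∀ L : ℝ, 0 < L → ∀ f₀ ∈ holderBall W β L,
        ∀ d₂ : ℝ, 0 < d₂ → ∃ d₁ : ℝ, 0 < d₁ ∧ ∀ᶠ n : ℕ in atTop,
          ENNReal.ofReal (Real.exp (-(d₂ * n * rateHT κ β n ^ 2))) ≤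
            waveletPrior W (scaleHT α) h
              {f | supNorm (f - f₀) < ENNReal.ofReal (d₁ * rateHT κ β n)}) ∧
    ((∀ᵐ x ∂(coefLaw W.J scaleOT h), Summable fun i => x i • W.basis i) ∧
      ∀ β : ℝ, 0 < β → ∀ L : ℝ, 0 < L → ∀ f₀ ∈ holderBall W β L,
        ∀ d₂ : ℝ, 0 < d₂ → ∃ d₁ : ℝ, 0 < d₁ ∧ ∀ᶠ n : ℕ in atTop,
          ENNReal.ofReal (Real.exp (-(d₂ * n * rateOT κ β n ^ 2))) ≤
            waveletPrior W scaleOT h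
              {f | supNorm (f - f₀) < ENNReal.ofReal (d₁ * rateOT κ β n)}) := by
  refine ⟨fun α hα => ⟨?_, fun β hβ hβα L hL f₀ hf₀ d₂ hd₂ => ?_⟩, ?_,
    fun β hβ L hL f₀ hf₀ d₂ hd₂ => ?_⟩
  · exact ae_summable_series W hh htail (C := 1) hα (scaleHT_pos α) fun l => (one_mul _).ge
  · exact eventually_le_waveletPrior W hκ hc₁ hc₂ hh htail le_rfl one_pos (by linarith) hα hβ hβα hL
      (scaleHT_pos α) (fun l => (one_mul _).ge) (exp_neg_le_scaleHT (by linarith))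
      (eventually_rateLog_le_rateHT hβ) hf₀ hd₂
  · exact ae_summable_series W hh htail (α := 1) (by norm_num) scaleOT_pos (scaleOT_le 1)
  -- Here `α` is free; `max β 1` meets both `β ≤ α` and `1/2 < α`.
  · exact eventually_le_waveletPrior W hκ hc₁ hc₂ hh htail one_le_two (by positivity) zero_le_one
      (α := max β 1) (lt_max_of_lt_right (by norm_num)) hβ (le_max_left _ _) hL scaleOT_pos
      (scaleOT_le _) exp_neg_le_scaleOT
      (Eventually.of_forall fun n => (rateLog_eq_rateOT κ β n).le) hf₀ hd₂
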